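/- **Setting.** Let $(\Omega,\mathcal F,\mathbb P)$ be a complete probability space, $T\in(0,\infty)$, $W$ a standard $m$-dimensional Brownian motion and $N$ a Poisson random measure on $[0,\infty)\times\mathbb R^d_*$, $\mathbb R^d_*=\mathbb R^d\setminus\{0\}$, independent of $W$, with intensity $\ell_1\otimes\nu$, where $\ell_1$ is Lebesgue measure and $\nu$ is $\sigma$-finite with $\int(1\wedge|x|^2)\,d\nu(x)<\infty$. Put $\tilde N=N-\ell_1\otimes\nu$ and $\Lambda^2=L^2(\mathbb R^d_*,\nu)$. Let $(\mathcal F_t)_{t\ge0}$ be the complete right-continuous augmentation of the filtration generated by $W$ and $N$, and let $\mathcal P$ be its predictable $\sigma$-algebra. Let $g:\Omega\times[0,T]\times\mathbb R\times\mathbb R^m\times\Lambda^2\to\mathbb R$ be $\mathcal P\otimes\mathscr B(\mathbb R)\otimes\mathscr B(\mathbb R^m)\otimes\mathscr B(\Lambda^2)$-measurable and let $X$ be $\mathcal F_T$-measurable. Let $(\rho,Z,U)$, $\rho=\rho(X)$, solve the BSDE with parameters $(g,T,X)$: $\rho$ is càdlàg and adapted with $\mathbb E[\sup_{t\le T}|\rho_t|^2]<\infty$;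 $Z$ and $U$ are predictable, with values in $\mathbb R^m$ and $\Lambda^2$, with $\mathbb E\int_0^T(|Z_t|^2+\|U_t\|_{\Lambda^2}^2)\,dt<\infty$; $\int_0^T|g(s,\rho_s,Z_s,U_s)|\,ds<\infty$ a.s.; and for every $t\in[0,T]$, a.s., $$\rho_t=X+\int_t^Tg(s,\rho_s,Z_s,U_s)\,ds-\int_t^TZ_s\cdot dW_s-\int_{(t,T]\times\mathbb R^d_*}U_s(x)\,d\tilde N(s,x).$$ Write $\psi_t=g(t,\rho_t,Z_t,U_t)$, and let $\mathcal T_T$ be the set of stopping times $\tau:\Omega\to[0,T]$ with $\mathbb P(\tau<T)>0$. For $\tau\in\mathcal T_T$ the *resilience rate* of $\rho$ at $\tau$ is $$\dot\rho_\tau(X)=\lim_{\varepsilon\to0^+}\frac1\varepsilon\,\mathbb E\big[\rho_{(\tau+\varepsilon)\wedge T}-\rho_\tau\,\big|\,\tau<T\big],$$ and for $\sigma\in\mathcal T_T$ with $\sigma\le\tau$ a.s. the *conditional resilience rate in $L^q$* is $$\dot\rho_{\tau|\sigma}(X)=L^q\text{-}\lim_{\varepsilon\to0^+}\frac{\mathbb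 E\big[\rho_{(\tau+\varepsilon)\wedge T}-\rho_\tau\,\big|\,\mathcal F_\sigma\big]}{\varepsilon\,\mathbb P(\tau<T)},$$ whenever these limits exist. (The process $\rho$ is of class (D) on $[0,T]$, so the expectations make sense; this is part of the claim.) **Theorem.** Let $q\in[1,\infty)$. (i) If $\mathbb E\int_0^T|\psi_t|^q\,dt<\infty$, then for $\ell_1$-a.e. $t\in[0,T)$ we have $\psi_t\in L^q$, and for all $s\in[0,t]$ both $\dot\rho_{t|s}(X)$ (in $L^q$) and $\dot\rho_t(X)$ exist, are finite, and satisfy $$\dot\rho_{t|s}(X)=-\mathbb E[\psi_t\,|\,\mathcal F_s]\ \text{ a.s.},\qquad \dot\rho_t(X)=-\mathbb E[\psi_t].$$ (ii) Assume that a.s. the right limit $\lim_{s\to t^+}\psi_s$ exists in $\mathbb R$ for every $t\in[0,T)$, that a.s. the path $\psi$ has at most countably many discontinuities on $[0,T]$, and that $\mathbb E[\sup_{t\in[0,T]}|\psi_t|^q]<\infty$. Then for all $\tau,\sigma\in\mathcal T_T$ with $\sigma\le\tau$ a.s., the variable $\mathbf 1_{\{\tau<T\}}\lim_{s\to\tau^+}\psi_s$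 is in $L^q$, both $\dot\rho_{\tau|\sigma}(X)$ (in $L^q$) and $\dot\rho_\tau(X)$ exist, are finite, and satisfy $$\dot\rho_{\tau|\sigma}(X)=-\frac{\mathbb E\big[\mathbf 1_{\{\tau<T\}}\lim_{s\to\tau^+}\psi_s\,\big|\,\mathcal F_\sigma\big]}{\mathbb P(\tau<T)}\ \text{ a.s.},\qquad \dot\rho_\tau(X)=-\mathbb E\Big[\lim_{s\to\tau^+}\psi_s\,\Big|\,\tau<T\Big].$$ -/

import Mathlib

open MeasureTheory ProbabilityTheory Filter Topology
open scoped NNReal ENNReal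

noncomputable section

namespace Resilience

/-! ### State spaces -/

/-- Euclidean `k`-space. -/
abbrev Euc (k : ℕ) : Type := EuclideanSpace ℝ (Fin k)

/-- The punctured space `ℝ^d \ {0}`, in which the jump marks live. -/
abbrev Punctured (d : ℕ) : Type := {x : Euc d // x ≠ 0}

/-- The Hilbert space `Λ² = L²(ℝ^d \ {0}, ν)`. -/
abbrev Lambda2 {d : ℕ} (ν : Measure (Punctured d)) : Type := Lp ℝ 2 ν

/-- `Λ²` carries its Borel σ-algebra. -/
instance {d : ℕ} (ν : Measure (Punctured d)) : MeasurableSpace (Lambda2 ν) := borel _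

instance {d : ℕ} (ν : Measure (Punctured d)) : BorelSpace (Lambda2 ν) := ⟨rfl⟩

/-- Lebesgue measure on the time axis `[0, ∞)`. -/
def leb : Measure ℝ≥0 := (volume : Measure ℝ).comap (fun t : ℝ≥0 => (t : ℝ))

/-! ### Brownian motion, Poisson random measures and their filtration -/

/-- `N` is a Poisson random measure on `E` with intensity measure `μ`: it takes values in
`{0, 1, 2, …, ∞}`, the variable `N(A)` has the Poisson law with mean `μ(A)` (almost surely infinite
if `μ(A) = ∞`), and the values of `N` on pairwise disjoint sets are independent. -/
structure IsPoissonRandomMeasure {Ω E : Type*} [MeasurableSpace Ω] [MeasurableSpace E]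
    (N : Ω → Measure E) (μ : Measure E) (P : Measure Ω) : Prop where
  measurable : ∀ A : Set E, MeasurableSet A → Measurable (fun ω => N ω A)
  nat_valued : ∀ ω, ∀ A : Set E, MeasurableSet A → ∃ k : ℕ∞, N ω A = (k : ℝ≥0∞)
  law : ∀ A : Set E, MeasurableSet A → μ A ≠ ∞ →
    P.map (fun ω => N ω A) = (poissonMeasure (μ A).toNNReal).map (fun k : ℕ => (k : ℝ≥0∞))
  law_top : ∀ A : Set E, MeasurableSet A → μ A = ∞ → ∀ᵐ ω ∂P, N ω A = ∞
  indep : ∀ (n : ℕ) (A : Fin n → Set E), (∀ i, MeasurableSet (A i)) →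
    Pairwise (fun i j => Disjoint (A i) (A j)) → iIndepFun (fun i ω => N ω (A i)) P

/-- `ν` integrates `1 ∧ |x|²`. -/
def IsLevyMeasure {d : ℕ} (ν : Measure (Punctured d)) : Prop :=
  ∫⁻ x, ENNReal.ofReal (min 1 (‖(x : Euc d)‖ ^ 2)) ∂ν < ∞

variable {Ω : Type*} [mΩ : MeasurableSpace Ω]

/-- The driving noise: a standard `m`-dimensional Brownian motion `W` and, independent of it, a
Poisson random measure `N` on `[0, ∞) × (ℝ^d \ {0})` with intensity `Lebesgue ⊗ ν`. -/
structure Noise (P : Measure Ω) (m : ℕ) {d : ℕ} (ν : Measure (Punctured d)) where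
  /-- the Brownian motion -/
  W : ℝ≥0 → Ω → Euc m
  /-- the Poisson random measure -/
  N : Ω → Measure (ℝ≥0 × Punctured d)
  measurable_W : ∀ t, Measurable (W t)
  brownian : ∀ j : Fin m, IsBrownianReal (fun t ω => W t ω j) P
  indep_components : iIndepFun (fun (j : Fin m) ω (t : ℝ≥0) => W t ω j) P
  poisson : IsPoissonRandomMeasure N (leb.prod ν) P
  indep : Indep (⨆ t : ℝ≥0, MeasurableSpace.comap (W t) inferInstance)
    (⨆ (A : Set (ℝ≥0 × Punctured d)) (_ : MeasurableSet A),
      MeasurableSpace.comap (fun ω => N ω A) inferInstance) P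

namespace Noise

variable {P : Measure Ω} {m d : ℕ} {ν : Measure (Punctured d)} (B : Noise P m ν)

/-- `σ(W_r, N([0,r] × A) : r ≤ t, A Borel)`. -/
@[reducible] def rawSigma (t : ℝ≥0) : MeasurableSpace Ω :=
  (⨆ (r : ℝ≥0) (_ : r ≤ t), MeasurableSpace.comap (B.W r) inferInstance) ⊔
  (⨆ (r : ℝ≥0) (_ : r ≤ t) (A : Set (Punctured d)) (_ : MeasurableSet A),
    MeasurableSpace.comap (fun ω => B.N ω (Set.Icc 0 r ×ˢ A)) inferInstance)

theorem rawSigma_mono : Monotone B.rawSigma := fun _ _ hst =>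
  sup_le_sup (biSup_mono fun _ h => h.trans hst) (biSup_mono fun _ h => h.trans hst)

theorem rawSigma_le (t : ℝ≥0) : B.rawSigma t ≤ mΩ := by
  refine sup_le (iSup₂_le fun r _ => (B.measurable_W r).comap_le) ?_
  refine iSup₂_le fun r _ => iSup₂_le fun A hA => ?_
  exact (B.poisson.measurable _ (measurableSet_Icc.prod hA)).comap_le

/-- The Brownian–Poissonian filtration: the right-continuous and complete augmentation of
`rawSigma`. -/
def filtration : Filtration ℝ≥0 mΩ where
  seq t := B.rawSigma t ⊔ (⨅ (s : ℝ≥0) (_ : t < s), B.rawSigma s) ⊔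
    MeasurableSpace.generateFrom {A : Set Ω | MeasurableSet A ∧ P A = 0}
  mono' _ _ hst := sup_le_sup (sup_le_sup (B.rawSigma_mono hst)
    (le_iInf₂ fun r hr => iInf₂_le r (hst.trans_lt hr))) le_rfl
  le' t := by
    refine sup_le (sup_le (B.rawSigma_le t) ?_) ?_
    · exact (iInf₂_le (t + 1) (by simp)).trans (B.rawSigma_le _)
    · exact MeasurableSpace.generateFrom_le fun A hA => hA.1

/-- The compensated measure `Ñ((s,t] × A) = N((s,t] × A) - (t - s) ν(A)`, used for `s ≤ t` and
`ν(A) < ∞`. -/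
def compensated (s t : ℝ≥0) (A : Set (Punctured d)) (ω : Ω) : ℝ :=
  (B.N ω (Set.Ioc s t ×ˢ A)).toReal - ((t : ℝ) - s) * (ν A).toReal

end Noise

/-! ### Spaces of processes on `[0,T]`

Processes are functions `ℝ≥0 → Ω → E`; only their restrictions to `[0,T]` matter. -/

/-- The predictable σ-algebra, restricted to `[0,T] × Ω`. -/
@[reducible] def predictableOn (𝓕 : Filtration ℝ≥0 mΩ) (T : ℝ≥0) :
    MeasurableSpace {p : ℝ≥0 × Ω // p.1 ≤ T} :=
  𝓕.predictable.comap Subtype.val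

/-- Càdlàg on `[0,T]`. -/
def CadlagOn (T : ℝ≥0) (f : ℝ≥0 → ℝ) : Prop :=
  (∀ t < T, ContinuousWithinAt f (Set.Ioi t) t) ∧
  ∀ t, 0 < t → t ≤ T → ∃ l : ℝ, Tendsto f (𝓝[<] t) (𝓝 l)

/-- The space `𝒮²_T`. -/
structure MemS2 (𝓕 : Filtration ℝ≥0 mΩ) (P : Measure Ω) (T : ℝ≥0) (Y : ℝ≥0 → Ω → ℝ) : Prop where
  adapted : ∀ t ≤ T, Measurable[𝓕 t] (Y t)
  cadlag : ∀ ω, CadlagOn T (fun t => Y t ω)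
  sup_sq : ∫⁻ ω, ⨆ t ∈ Set.Icc 0 T, ‖Y t ω‖ₑ ^ 2 ∂P < ∞

/-- The space `ℋ²_T(E)`. -/
structure MemH2 {E : Type*} [NormedAddCommGroup E] [MeasurableSpace E]
    (𝓕 : Filtration ℝ≥0 mΩ) (P : Measure Ω) (T : ℝ≥0) (Z : ℝ≥0 → Ω → E) : Prop where
  predictable : Measurable[predictableOn 𝓕 T] (fun p : {p : ℝ≥0 × Ω // p.1 ≤ T} => Z p.1.1 p.1.2)
  sq_integrable : ∫⁻ ω, ∫⁻ t in Set.Icc 0 T, ‖Z t ω‖ₑ ^ 2 ∂leb ∂P < ∞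

/-- The process `Y` is of class `(D)` on `[0,T]`: its values at the `[0,T]`-valued stopping times
are uniformly integrable. -/
def ClassD (𝓕 : Filtration ℝ≥0 mΩ) (P : Measure Ω) (T : ℝ≥0) (Y : ℝ≥0 → Ω → ℝ) : Prop :=
  UniformIntegrable
    (fun (τ : {τ : Ω → ℝ≥0 // IsStoppingTime 𝓕 (fun ω => (τ ω : WithTop ℝ≥0)) ∧ ∀ ω, τ ω ≤ T}) ω =>
      Y (τ.1 ω) ω) 1 P

/-- The stopping times `τ ≤ T` with `P(τ < T) > 0`. -/
structure IsAdmissibleTime (𝓕 : Filtration ℝ≥0 mΩ) (P : Measure Ω) (T : ℝ≥0)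
    (τ : Ω → ℝ≥0) : Prop where
  isStoppingTime : IsStoppingTime 𝓕 (fun ω => (τ ω : WithTop ℝ≥0))
  le_horizon : ∀ ω, τ ω ≤ T
  pos : 0 < P {ω | τ ω < T}

/-! ### Stochastic integrals -/

section Integrals

variable {P : Measure Ω} {m d : ℕ} {ν : Measure (Punctured d)}

/-- A simple predictable integrand `∑ᵢ 1_{(sᵢ,tᵢ]} ξᵢ` for the Brownian motion, with `ξᵢ` bounded
and `𝓕_{sᵢ}`-measurable. -/
structure SimpleBrownian (𝓕 : Filtration ℝ≥0 mΩ) (m : ℕ) where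
  n : ℕ
  s : Fin n → ℝ≥0
  t : Fin n → ℝ≥0
  le : ∀ i, s i ≤ t i
  ξ : Fin n → Ω → Euc m
  measurable : ∀ i, Measurable[𝓕 (s i)] (ξ i)
  bounded : ∀ i, ∃ C : ℝ, ∀ ω, ‖ξ i ω‖ ≤ C

/-- The integrand as a process. -/
def SimpleBrownian.process {𝓕 : Filtration ℝ≥0 mΩ} (H : SimpleBrownian 𝓕 m)
    (r : ℝ≥0) (ω : Ω) : Euc m :=
  ∑ i, (Set.Ioc (H.s i) (H.t i)).indicator (fun _ => H.ξ i ω) r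

/-- `∫₀ʳ H · dW = ∑ᵢ ξᵢ · (W_{tᵢ ∧ r} - W_{sᵢ ∧ r})`. -/
def SimpleBrownian.integral {𝓕 : Filtration ℝ≥0 mΩ} (H : SimpleBrownian 𝓕 m)
    (W : ℝ≥0 → Ω → Euc m) (r : ℝ≥0) (ω : Ω) : ℝ :=
  ∑ i, inner ℝ (H.ξ i ω) (W (min (H.t i) r) ω - W (min (H.s i) r) ω)

/-- `I` is (a version of) the Itô integral process `∫₀^· Z · dW` on `[0,T]`: the continuous adapted
process that is the `L²`-limit of the integrals of simple predictable processes approximating `Z`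
in `L²(P ⊗ dt)`. -/
structure IsBrownianIntegral (B : Noise P m ν) (T : ℝ≥0) (Z : ℝ≥0 → Ω → Euc m)
    (I : ℝ≥0 → Ω → ℝ) : Prop where
  adapted : ∀ t ≤ T, Measurable[B.filtration t] (I t)
  continuous : ∀ ω, ContinuousOn (fun t => I t ω) (Set.Icc 0 T)
  approx : ∃ H : ℕ → SimpleBrownian B.filtration m,
    Tendsto (fun k => ∫⁻ ω, ∫⁻ t in Set.Icc 0 T, ‖(H k).process t ω - Z t ω‖ₑ ^ 2 ∂leb ∂P)
      atTop (𝓝 0) ∧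
    ∀ t ≤ T, Tendsto (fun k => eLpNorm (fun ω => (H k).integral B.W t ω - I t ω) 2 P) atTop (𝓝 0)

/-- A simple predictable integrand `∑ᵢ 1_{(sᵢ,tᵢ]} ξᵢ 1_{Aᵢ}` for the compensated Poisson random
measure, with `ξᵢ` bounded and `𝓕_{sᵢ}`-measurable, and `ν(Aᵢ) < ∞`. -/
structure SimplePoisson (𝓕 : Filtration ℝ≥0 mΩ) (ν : Measure (Punctured d)) where
  n : ℕ
  s : Fin n → ℝ≥0
  t : Fin n → ℝ≥0
  le : ∀ i, s i ≤ t i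
  A : Fin n → Set (Punctured d)
  measurableSet : ∀ i, MeasurableSet (A i)
  finite : ∀ i, ν (A i) ≠ ∞
  ξ : Fin n → Ω → ℝ
  measurable : ∀ i, Measurable[𝓕 (s i)] (ξ i)
  bounded : ∀ i, ∃ C : ℝ, ∀ ω, |ξ i ω| ≤ C

/-- The integrand as a `Λ²`-valued process. -/
def SimplePoisson.process {𝓕 : Filtration ℝ≥0 mΩ} (H : SimplePoisson 𝓕 ν)
    (r : ℝ≥0) (ω : Ω) : Lambda2 ν :=
  ∑ i, (Set.Ioc (H.s i) (H.t i)).indicator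
    (fun _ => H.ξ i ω • indicatorConstLp 2 (H.measurableSet i) (H.finite i) (1 : ℝ)) r

/-- `∫_{(0,r] × (ℝ^d \ {0})} H dÑ = ∑ᵢ ξᵢ Ñ((sᵢ ∧ r, tᵢ ∧ r] × Aᵢ)`. -/
def SimplePoisson.integral (B : Noise P m ν) (H : SimplePoisson B.filtration ν)
    (r : ℝ≥0) (ω : Ω) : ℝ :=
  ∑ i, H.ξ i ω * B.compensated (min (H.s i) r) (min (H.t i) r) (H.A i) ω

/-- `J` is (a version of) the integral process `∫_{(0,·] × (ℝ^d \ {0})} U dÑ` on `[0,T]`: the càdlàg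
adapted process that is the `L²`-limit of the integrals of simple predictable processes
approximating `U` in `L²(P ⊗ dt; Λ²)`. -/
structure IsPoissonIntegral (B : Noise P m ν) (T : ℝ≥0) (U : ℝ≥0 → Ω → Lambda2 ν)
    (J : ℝ≥0 → Ω → ℝ) : Prop where
  adapted : ∀ t ≤ T, Measurable[B.filtration t] (J t)
  cadlag : ∀ ω, CadlagOn T (fun t => J t ω)
  approx : ∃ H : ℕ → SimplePoisson B.filtration ν,
    Tendsto (fun k => ∫⁻ ω, ∫⁻ t in Set.Icc 0 T, ‖(H k).process t ω - U t ω‖ₑ ^ 2 ∂leb ∂P)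
      atTop (𝓝 0) ∧
    ∀ t ≤ T, Tendsto (fun k => eLpNorm (fun ω => (H k).integral B t ω - J t ω) 2 P) atTop (𝓝 0)

/-! ### Backward stochastic differential equations -/

/-- `g` is a driver: jointly measurable in `(t, ω)` (with respect to the predictable σ-algebra on
`[0,T] × Ω`), `y`, `z` and `u`. -/
def IsDriver (𝓕 : Filtration ℝ≥0 mΩ) (T : ℝ≥0)
    (g : ℝ≥0 → Ω → ℝ → Euc m → Lambda2 ν → ℝ) : Prop :=
  Measurable[(predictableOn 𝓕 T).prod inferInstance]
    (fun p : {p : ℝ≥0 × Ω // p.1 ≤ T} × ℝ × Euc m × Lambda2 ν =>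
      g p.1.1.1 p.1.1.2 p.2.1 p.2.2.1 p.2.2.2)

/-- The process `g(t, Y_t, Z_t, U_t)`. -/
def driverAlong (g : ℝ≥0 → Ω → ℝ → Euc m → Lambda2 ν → ℝ)
    (Y : ℝ≥0 → Ω → ℝ) (Z : ℝ≥0 → Ω → Euc m) (U : ℝ≥0 → Ω → Lambda2 ν) (t : ℝ≥0) (ω : Ω) : ℝ :=
  g t ω (Y t ω) (Z t ω) (U t ω)

/-- `(Y, Z, U)` solves the BSDE with parameters `(g, T, X)`: for every `t ∈ [0,T]`, a.s.,
`Y_t = X + ∫ₜᵀ g(s,Y_s,Z_s,U_s) ds - ∫ₜᵀ Z_s · dW_s - ∫_{(t,T] × (ℝ^d \ {0})} U_s(x) dÑ(s,x)`. -/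
structure IsBSDESolution (B : Noise P m ν) (T : ℝ≥0) (g : ℝ≥0 → Ω → ℝ → Euc m → Lambda2 ν → ℝ)
    (X : Ω → ℝ) (Y : ℝ≥0 → Ω → ℝ) (Z : ℝ≥0 → Ω → Euc m) (U : ℝ≥0 → Ω → Lambda2 ν) : Prop where
  memS2 : MemS2 B.filtration P T Y
  memH2_Z : MemH2 B.filtration P T Z
  memH2_U : MemH2 B.filtration P T U
  integrable : ∀ᵐ ω ∂P, IntegrableOn (fun s => driverAlong g Y Z U s ω) (Set.Icc 0 T) leb
  equation : ∃ I J : ℝ≥0 → Ω → ℝ, IsBrownianIntegral B T Z I ∧ IsPoissonIntegral B T U J ∧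
    ∀ t ≤ T, ∀ᵐ ω ∂P, Y t ω = X ω + (∫ s in Set.Ioc t T, driverAlong g Y Z U s ω ∂leb)
      - (I T ω - I t ω) - (J T ω - J t ω)

end Integrals

/-! ### Resilience rates -/

/-- The increment `Y_{(τ+ε) ∧ T} - Y_τ`. -/
def increment (T : ℝ≥0) (Y : ℝ≥0 → Ω → ℝ) (τ : Ω → ℝ≥0) (ε : ℝ≥0) (ω : Ω) : ℝ :=
  Y (min (τ ω + ε) T) ω - Y (τ ω) ω

/-- The class `(D)` process `Y` has the resilience rate `r` at `τ`: the expectations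
`ε⁻¹ E[Y_{(τ+ε) ∧ T} - Y_τ | τ < T]` tend to `r` in the extended reals as `ε → 0⁺`. -/
def HasResilienceRate (𝓕 : Filtration ℝ≥0 mΩ) (P : Measure Ω) (T : ℝ≥0) (Y : ℝ≥0 → Ω → ℝ)
    (τ : Ω → ℝ≥0) (r : EReal) : Prop :=
  ClassD 𝓕 P T Y ∧
  Tendsto (fun ε : ℝ≥0 =>
      (((ε : ℝ)⁻¹ * ∫ ω, increment T Y τ ε ω ∂(P[|{ω | τ ω < T}]) : ℝ) : EReal))
    (𝓝[>] 0) (𝓝 r)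

/-- The class `(D)` process `Y` has the conditional resilience rate `R` at `τ`, conditioned at the
stopping time `σ`, in the sense of `Lᵖ`: the random variables
`E[Y_{(τ+ε) ∧ T} - Y_τ | 𝓕_σ] / (ε P(τ < T))` tend to `R` in `Lᵖ` as `ε → 0⁺`. -/
def HasConditionalResilienceRate (𝓕 : Filtration ℝ≥0 mΩ) (P : Measure Ω) (T : ℝ≥0)
    (Y : ℝ≥0 → Ω → ℝ) (τ σ : Ω → ℝ≥0)
    (hσ : IsStoppingTime 𝓕 (fun ω => (σ ω : WithTop ℝ≥0))) (p : ℝ≥0∞) (R : Ω → ℝ) : Prop :=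
  ClassD 𝓕 P T Y ∧ MemLp R p P ∧
  Tendsto (fun ε : ℝ≥0 =>
      eLpNorm (fun ω => (P[increment T Y τ ε | hσ.measurableSpace]) ω /
        ((ε : ℝ) * P.real {ω | τ ω < T}) - R ω) p P)
    (𝓝[>] 0) (𝓝 0)

end Resilience

end

/-! Let `M` be the sum of the two stochastic integrals, so that the equation reads `ρ_b - ρ_a =
-∫_a^b ψ + (M_b - M_a)`. If `M` is a right-continuous martingale, optional stopping removes its
increment over `(τ, (τ + ε) ∧ T]` under `E[· | 𝓕_σ]`, `σ ≤ τ`. The difference quotient is then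
`-E[A_ε | 𝓕_σ] / P(τ < T)`, where `A_ε = ε⁻¹ ∫_τ^{(τ+ε)∧T} ψ`. Conditional expectation contracts
`Lᵠ`, so both rates follow once `A_ε` converges in `Lᵠ` (`HasDrift.hasConditionalResilienceRate`,
`HasDrift.hasResilienceRate`).

For deterministic times, Lebesgue differentiation along paths and Fubini give `A_ε → ψ_t` a.s. for
almost every `t`. By Jensen `|A_ε|^q` is at most the average of `|ψ|^q`; for almost every `t` these
averages converge a.s. and, by differentiation of `t ↦ E|ψ_t|^q`, so do their expectations.
Dominated convergence with varying majorants, `tendsto_eLpNorm_of_tendsto_majorant`, gives the `Lᵠ`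
limit. The exceptional set of times does not depend on `s`. For stopping times, pathwise right
limits give the a.s. convergence and `sup |ψ|^q` the domination.

The integrals are defined only as `L²` limits of simple ones, so the martingale property has to be
proved. `CenteredIncrements` isolates orthogonality of increments to the past, without adaptedness
or integrability of the values, and is stable under sums, elementary transforms and `L¹` limits. It
holds for the noise because increments are independent of the raw past; `L¹` right-continuity
carries it over to the augmented filtration. -/

noncomputable section

set_option linter.unusedSectionVars false

namespace Resilience

/-! ### Right-continuous processes at random times. -/

section

/-! ### Discretization of time from the right -/

/-- The successor of `t` in the grid of mesh `1 / (n + 1)`, truncated at `T`. -/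
def timeGrid (T : ℝ≥0) (n : ℕ) (t : ℝ≥0) : ℝ≥0 :=
  min (((⌊t * (n + 1)⌋₊ : ℝ≥0) + 1) / (n + 1)) T

theorem timeGrid_le (T : ℝ≥0) (n : ℕ) (t : ℝ≥0) : timeGrid T n t ≤ T := min_le_right _ _

/-- Strictness is why the grid uses floor plus one and not the ceiling: `t` is approached through
`𝓝[>] t` even when it is a grid point. -/
theorem lt_floor_add_one_div (n : ℕ) (t : ℝ≥0) :
    t < ((⌊t * (n + 1)⌋₊ : ℝ≥0) + 1) / (n + 1) := by
  rw [lt_div_iff₀ (by positivity)]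
  exact Nat.lt_floor_add_one _

theorem le_timeGrid {T t : ℝ≥0} (h : t ≤ T) (n : ℕ) : t ≤ timeGrid T n t :=
  le_min (lt_floor_add_one_div n t).le h

theorem lt_timeGrid {T t : ℝ≥0} (h : t < T) (n : ℕ) : t < timeGrid T n t :=
  lt_min (lt_floor_add_one_div n t) h

theorem timeGrid_horizon (T : ℝ≥0) (n : ℕ) : timeGrid T n T = T :=
  le_antisymm (timeGrid_le T n T) (le_timeGrid le_rfl n)

theorem tendsto_timeGrid {T t : ℝ≥0} (h : t ≤ T) :
    Tendsto (fun n => timeGrid T n t) atTop (𝓝 t) := by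
  refine tendsto_of_tendsto_of_tendsto_of_le_of_le tendsto_const_nhds
    (h := fun n : ℕ => t + 1 / ((n : ℝ≥0) + 1)) ?_ (fun n => le_timeGrid h n) (fun n => ?_)
  · simpa using tendsto_const_nhds.add
      (tendsto_one_div_add_atTop_nhds_zero_nat (𝕜 := ℝ≥0))
  · refine (min_le_left _ _).trans ?_
    have h0 : (0 : ℝ≥0) < (n : ℝ≥0) + 1 := by positivity
    rw [div_le_iff₀ h0, add_mul, one_div, inv_mul_cancel₀ h0.ne']
    gcongr
    exact Nat.floor_le (by positivity)

theorem tendsto_timeGrid_nhdsGT {T t : ℝ≥0} (h : t < T) :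
    Tendsto (fun n => timeGrid T n t) atTop (𝓝[>] t) :=
  tendsto_nhdsWithin_iff.2 ⟨tendsto_timeGrid h.le, .of_forall fun n => lt_timeGrid h n⟩

/-- Along the discretizations from the right, a right-continuous path converges. -/
theorem tendsto_comp_timeGrid {T t : ℝ≥0} {f : ℝ≥0 → ℝ} (h : t ≤ T)
    (hf : ∀ s < T, ContinuousWithinAt f (Set.Ioi s) s) :
    Tendsto (fun n => f (timeGrid T n t)) atTop (𝓝 (f t)) := by
  rcases h.lt_or_eq with h | rfl
  · exact (hf t h).tendsto.comp (tendsto_timeGrid_nhdsGT h)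
  · simp [timeGrid_horizon]

variable {Ω : Type*} [mΩ : MeasurableSpace Ω]

/-- A right-continuous process on `[0,T]` is jointly measurable. -/
theorem measurable_uncurry_min_of_rightContinuous {T : ℝ≥0} {Y : ℝ≥0 → Ω → ℝ}
    (hY : ∀ t ≤ T, Measurable (Y t))
    (hc : ∀ ω, ∀ s < T, ContinuousWithinAt (fun t => Y t ω) (Set.Ioi s) s) :
    Measurable (fun p : ℝ≥0 × Ω => Y (min p.1 T) p.2) := by
  refine measurable_of_tendsto_metrizable
    (f := fun n (p : ℝ≥0 × Ω) => Y (timeGrid T n (min p.1 T)) p.2) (fun n => ?_) ?_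
  -- At level `n` the process depends on time only through a natural number, so it factors through
  -- `ℕ × Ω`, where measurability is checked on each fibre.
  · have h : Measurable (fun q : ℕ × Ω => Y (min (((q.1 : ℝ≥0) + 1) / (n + 1)) T) q.2) :=
      measurable_from_prod_countable_right fun k =>
        hY (min (((k : ℝ≥0) + 1) / (n + 1)) T) (min_le_right _ _)
    have h' : Measurable fun p : ℝ≥0 × Ω => (⌊min p.1 T * ((n : ℝ≥0) + 1)⌋₊, p.2) :=
      (Nat.measurable_floor.comp ((measurable_fst.min measurable_const).mul_const _)).prodMk
        measurable_snd
    have h'' := h.comp h'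
    simp only [Function.comp_def] at h''
    simp only [timeGrid]
    exact h''
  · rw [tendsto_pi_nhds]
    exact fun p => tendsto_comp_timeGrid (min_le_right _ _) (hc p.2)

theorem measurable_comp_time {T : ℝ≥0} {Y : ℝ≥0 → Ω → ℝ}
    (hY : ∀ t ≤ T, Measurable (Y t))
    (hc : ∀ ω, ∀ s < T, ContinuousWithinAt (fun t => Y t ω) (Set.Ioi s) s)
    {τ : Ω → ℝ≥0} (hτ : Measurable τ) (hle : ∀ ω, τ ω ≤ T) :
    Measurable (fun ω => Y (τ ω) ω) := by
  convert (measurable_uncurry_min_of_rightContinuous hY hc).comp (hτ.prodMk measurable_id) using 2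
    with ω
  simp [min_eq_left (hle ω)]

/-! ### Stopping times with values in `[0, ∞)` -/

variable {𝓕 : Filtration ℝ≥0 mΩ}

theorem measurable_of_isStoppingTime {τ : Ω → ℝ≥0}
    (hτ : IsStoppingTime 𝓕 (fun ω => (τ ω : WithTop ℝ≥0))) : Measurable τ :=
  measurable_of_Iic fun i => 𝓕.le i _ (by
    have := hτ.measurableSet_le i
    simp only [WithTop.coe_le_coe] at this
    exact this)

/-- For `i < T`, the rounded time is at most `i` exactly when `τ` lies strictly below the last grid
point not exceeding `i`, and that event is known by time `i`. -/
theorem isStoppingTime_timeGrid {τ : Ω → ℝ≥0}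
    (hτ : IsStoppingTime 𝓕 (fun ω => (τ ω : WithTop ℝ≥0))) (T : ℝ≥0) (n : ℕ) :
    IsStoppingTime 𝓕 (fun ω => (timeGrid T n (τ ω) : WithTop ℝ≥0)) := by
  intro i
  simp only [WithTop.coe_le_coe]
  rcases le_or_gt T i with hi | hi
  · simp [(timeGrid_le T n _).trans hi]
  · have h0 : (0 : ℝ≥0) < (n : ℝ≥0) + 1 := by positivity
    have h := hτ.measurableSet_lt ((⌊i * (n + 1)⌋₊ : ℝ≥0) / (n + 1))
    simp only [WithTop.coe_lt_coe] at h
    have hle : (⌊i * (n + 1)⌋₊ : ℝ≥0) / (n + 1) ≤ i := by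
      rw [div_le_iff₀ h0]
      exact Nat.floor_le (by positivity)
    convert 𝓕.mono hle _ h using 1
    ext ω
    simp only [Set.mem_ofPred_eq, timeGrid, min_le_iff, hi.not_ge, or_false]
    rw [div_le_iff₀ h0, lt_div_iff₀ h0, ← Nat.floor_lt (by positivity), ← Nat.cast_succ,
      ← Nat.le_floor_iff (by positivity), Nat.succ_le_iff]

theorem isStoppingTime_add_min {τ : Ω → ℝ≥0}
    (hτ : IsStoppingTime 𝓕 (fun ω => (τ ω : WithTop ℝ≥0))) (T ε : ℝ≥0) :
    IsStoppingTime 𝓕 (fun ω => (min (τ ω + ε) T : ℝ≥0) |> fun t => (t : WithTop ℝ≥0)) := by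
  intro i
  simp only [WithTop.coe_le_coe]
  rcases le_or_gt T i with hi | hi
  · simp [hi]
  · simp only [min_le_iff, hi.not_ge, or_false]
    rcases le_or_gt ε i with h | h
    · have h' := hτ.measurableSet_le (i - ε)
      simp only [WithTop.coe_le_coe] at h'
      convert 𝓕.mono tsub_le_self _ h' using 3 with ω
      exact (le_tsub_iff_right h).symm
    · convert MeasurableSet.empty
      ext ω
      simp only [Set.mem_ofPred_eq, Set.mem_empty_iff_false, iff_false, not_le]
      exact h.trans_le le_add_self

/-! ### Optional stopping for right-continuous martingales -/

variable {P : Measure Ω} [IsProbabilityMeasure P]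

/-- The grid times decrease the problem to countably many values, where `M` stopped is a conditional
expectation of `M T`. Such a family is uniformly integrable, so right-continuity gives `L¹`
convergence, and an event of `𝓕_τ` belongs to the σ-algebra of every grid time above `τ`. -/
theorem integrable_and_setIntegral_stopped {T : ℝ≥0} {M : ℝ≥0 → Ω → ℝ}
    (hM : Martingale M 𝓕 P)
    (hc : ∀ ω, ∀ s < T, ContinuousWithinAt (fun t => M t ω) (Set.Ioi s) s)
    {τ : Ω → ℝ≥0} (hτ : IsStoppingTime 𝓕 (fun ω => (τ ω : WithTop ℝ≥0)))
    (hle : ∀ ω, τ ω ≤ T) :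
    Integrable (fun ω => M (τ ω) ω) P ∧ ∀ A, MeasurableSet[hτ.measurableSpace] A →
      ∫ ω in A, M (τ ω) ω ∂P = ∫ ω in A, M T ω ∂P := by
  have hs := fun n => isStoppingTime_timeGrid hτ T n
  have hcond : ∀ n, (fun ω => M (timeGrid T n (τ ω)) ω) =ᵐ[P] P[M T | (hs n).measurableSpace] := by
    intro n
    refine hM.stoppedValue_ae_eq_condExp_of_le_const_of_countable_range (hs n)
      (fun ω => WithTop.coe_le_coe.2 (timeGrid_le T n _)) ?_
    refine (Set.countable_range fun k : ℕ =>
      ((min (((k : ℝ≥0) + 1) / (n + 1)) T : ℝ≥0) : WithTop ℝ≥0)).mono ?_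
    rintro _ ⟨ω, rfl⟩
    exact ⟨⌊τ ω * (n + 1)⌋₊, rfl⟩
  have hui : UniformIntegrable (fun n ω => M (timeGrid T n (τ ω)) ω) 1 P :=
    ((hM.integrable T).uniformIntegrable_condExp fun n => (hs n).measurableSpace_le).ae_eq
      fun n => (hcond n).symm
  have hlim : ∀ᵐ ω ∂P, Tendsto (fun n => M (timeGrid T n (τ ω)) ω) atTop (𝓝 (M (τ ω) ω)) :=
    .of_forall fun ω => tendsto_comp_timeGrid (hle ω) (hc ω)
  have hmem : MemLp (fun ω => M (τ ω) ω) 1 P := hui.memLp_of_ae_tendsto hlim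
  have hL1 := tendsto_Lp_finite_of_tendsto_ae le_rfl ENNReal.one_ne_top hui.1 hmem hui.2.1 hlim
  refine ⟨memLp_one_iff_integrable.1 hmem, fun A hA => ?_⟩
  have hA' := hτ.measurableSpace_le _ hA
  have h1 := tendsto_setIntegral_of_L1' (fun ω => M (τ ω) ω) hmem.1
    (.of_forall fun n => memLp_one_iff_integrable.1 (hui.memLp n)) hL1 A
  refine tendsto_nhds_unique h1 ?_
  refine tendsto_const_nhds.congr fun n => ?_
  rw [setIntegral_congr_ae hA' ((hcond n).mono fun ω h _ => h),
    setIntegral_condExp (hs n).measurableSpace_le (hM.integrable T)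
      (hτ.measurableSpace_mono (hs n) (fun ω => WithTop.coe_le_coe.2 (le_timeGrid (hle ω) n)) _ hA)]

theorem condExp_stopped {T : ℝ≥0} {M : ℝ≥0 → Ω → ℝ}
    (hM : Martingale M 𝓕 P)
    (hc : ∀ ω, ∀ s < T, ContinuousWithinAt (fun t => M t ω) (Set.Ioi s) s)
    {τ σ : Ω → ℝ≥0} (hτ : IsStoppingTime 𝓕 (fun ω => (τ ω : WithTop ℝ≥0)))
    (hle : ∀ ω, τ ω ≤ T) (hσ : IsStoppingTime 𝓕 (fun ω => (σ ω : WithTop ℝ≥0)))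
    (hστ : ∀ᵐ ω ∂P, σ ω ≤ τ ω) :
    P[fun ω => M (τ ω) ω | hσ.measurableSpace] =ᵐ[P] P[M T | hσ.measurableSpace] := by
  obtain ⟨hint, heq⟩ := integrable_and_setIntegral_stopped hM hc hτ hle
  refine (ae_eq_condExp_of_forall_setIntegral_eq hσ.measurableSpace_le (hM.integrable T)
    (fun A _ _ => integrable_condExp.integrableOn) (fun A hA _ => ?_)
    stronglyMeasurable_condExp.aestronglyMeasurable)
  rw [setIntegral_condExp hσ.measurableSpace_le hint hA]
  -- Since `σ ≤ τ` holds only almost surely, `A` itself need not be in `𝓕_τ`; its intersection with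
  -- `{σ ≤ τ}` is, and differs from `A` by a null set.
  have hA' : MeasurableSet[hτ.measurableSpace] (A ∩ {ω | σ ω ≤ τ ω}) := by
    have h := hσ.measurableSet_inter_le hτ A hA
    rw [hσ.measurableSet_min_iff hτ] at h
    simpa only [WithTop.coe_le_coe] using h.2
  have hae : A =ᵐ[P] (A ∩ {ω | σ ω ≤ τ ω} : Set Ω) := by
    filter_upwards [hστ] with ω hω
    exact propext ⟨fun h => ⟨h, hω⟩, fun h => h.1⟩
  rw [setIntegral_congr_set hae, heq _ hA', ← setIntegral_congr_set hae]

end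

/-! ### Independence of noise increments from the raw past. -/

section

variable {Ω : Type*} [mΩ : MeasurableSpace Ω] {P : Measure Ω} [IsProbabilityMeasure P]

/-! ### Independence of the increments of the noise from its past -/

theorem generateFrom_image2_inter (m₁ m₂ : MeasurableSpace Ω) :
    MeasurableSpace.generateFrom
      (Set.image2 (· ∩ ·) {s | MeasurableSet[m₁] s} {s | MeasurableSet[m₂] s}) = m₁ ⊔ m₂ := by
  refine le_antisymm (MeasurableSpace.generateFrom_le ?_) (sup_le (fun s hs => ?_) fun s hs => ?_)
  · rintro _ ⟨s, hs, t, ht, rfl⟩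
    exact ((le_sup_left : m₁ ≤ m₁ ⊔ m₂) s hs).inter ((le_sup_right : m₂ ≤ m₁ ⊔ m₂) t ht)
  · exact MeasurableSpace.measurableSet_generateFrom ⟨s, hs, Set.univ, .univ, Set.inter_univ s⟩
  · exact MeasurableSpace.measurableSet_generateFrom ⟨Set.univ, .univ, s, hs, Set.univ_inter s⟩

/-- On the π-system of intersections, `P(A ∩ s ∩ t) = P(A ∩ s) P(t) = P(A) P(s) P(t)`. This lets the
past be enlarged one independent source at a time. -/
theorem Indep.sup_right_of_sup_left {m₁ m₂ m₃ : MeasurableSpace Ω} (hm₁ : m₁ ≤ mΩ) (hm₂ : m₂ ≤ mΩ)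
    (hm₃ : m₃ ≤ mΩ) (h₁₂ : Indep m₁ m₂ P) (h : Indep (m₁ ⊔ m₂) m₃ P) : Indep m₁ (m₂ ⊔ m₃) P := by
  refine IndepSets.indep (p1 := {s | MeasurableSet[m₁] s})
    (p2 := Set.image2 (· ∩ ·) {s | MeasurableSet[m₂] s} {s | MeasurableSet[m₃] s})
    hm₁ (sup_le hm₂ hm₃) (@MeasurableSpace.isPiSystem_measurableSet _ m₁) ?_
    (@MeasurableSpace.generateFrom_measurableSet _ m₁).symm (generateFrom_image2_inter m₂ m₃).symm ?_
  · rintro _ ⟨s, hs, t, ht, rfl⟩ _ ⟨s', hs', t', ht', rfl⟩ -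
    exact ⟨s ∩ s', MeasurableSet.inter hs hs', t ∩ t', MeasurableSet.inter ht ht',
      Set.inter_inter_inter_comm _ _ _ _⟩
  · rw [IndepSets_iff]
    rintro A _ hA ⟨s, hs, t, ht, rfl⟩
    rw [Indep_iff] at h h₁₂
    have hA' : MeasurableSet[m₁ ⊔ m₂] A := (le_sup_left : m₁ ≤ m₁ ⊔ m₂) A hA
    have hs' : MeasurableSet[m₁ ⊔ m₂] s := (le_sup_right : m₂ ≤ m₁ ⊔ m₂) s hs
    rw [← Set.inter_assoc, h _ _ (hA'.inter hs') ht, h _ _ hs' ht, h₁₂ _ _ hA hs, mul_assoc]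

namespace Noise

variable {m d : ℕ} {ν : Measure (Punctured d)} (B : Noise P m ν)

/-- `σ(W_r : r ≤ t)`. -/
@[reducible] def brownianPast (t : ℝ≥0) : MeasurableSpace Ω :=
  ⨆ (r : ℝ≥0) (_ : r ≤ t), MeasurableSpace.comap (B.W r) inferInstance

/-- `σ(N([0,r] × A) : r ≤ t, A Borel)`. -/
@[reducible] def poissonPast (t : ℝ≥0) : MeasurableSpace Ω :=
  ⨆ (r : ℝ≥0) (_ : r ≤ t) (A : Set (Punctured d)) (_ : MeasurableSet A),
    MeasurableSpace.comap (fun ω => B.N ω (Set.Icc 0 r ×ˢ A)) inferInstance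

theorem measurable_W_apply (j : Fin m) (t : ℝ≥0) : Measurable (fun ω => B.W t ω j) :=
  (by fun_prop : Measurable fun x : Euc m => x j).comp (B.measurable_W t)

theorem measurable_N {C : Set (ℝ≥0 × Punctured d)} (hC : MeasurableSet C) :
    Measurable (fun ω => B.N ω C) :=
  B.poisson.measurable C hC

theorem brownianPast_le (t : ℝ≥0) : B.brownianPast t ≤ mΩ :=
  iSup₂_le fun r _ => (B.measurable_W r).comap_le

theorem poissonPast_le (t : ℝ≥0) : B.poissonPast t ≤ mΩ :=
  iSup₂_le fun _ _ => iSup₂_le fun _ hA => (B.measurable_N (measurableSet_Icc.prod hA)).comap_le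

/-- `σ(Wʲ_r : r ≥ 0)`. -/
@[reducible] def componentSigma (j : Fin m) : MeasurableSpace Ω :=
  MeasurableSpace.comap (fun ω (t : ℝ≥0) => B.W t ω j) inferInstance

theorem measurable_component (j : Fin m) (t : ℝ≥0) :
    Measurable[B.componentSigma j] (fun ω => B.W t ω j) :=
  (measurable_pi_apply t).comp (comap_measurable (fun ω (t : ℝ≥0) => B.W t ω j))

theorem componentSigma_le (j : Fin m) : B.componentSigma j ≤ mΩ :=
  (measurable_pi_lambda _ fun t => B.measurable_W_apply j t).comap_le

/-- `σ(Wʲ_r : r ≤ t)`. -/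
@[reducible] def componentPast (j : Fin m) (t : ℝ≥0) : MeasurableSpace Ω :=
  MeasurableSpace.comap (fun ω (r : Set.Iic t) => B.W r ω j) inferInstance

theorem componentPast_le_componentSigma (j : Fin m) (t : ℝ≥0) :
    B.componentPast j t ≤ B.componentSigma j := by
  have h : Measurable[B.componentSigma j] (fun ω (r : Set.Iic t) => B.W r ω j) :=
    @measurable_pi_lambda _ _ _ (B.componentSigma j) _ _ fun r => B.measurable_component j r
  exact h.comap_le

/-- The other components enter with their whole trajectories. This costs nothing, as they are
independent of component `j` over all times. -/
theorem brownianPast_le_components (j : Fin m) (t : ℝ≥0) :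
    B.brownianPast t ≤ B.componentPast j t ⊔ ⨆ k ∈ ({j}ᶜ : Set (Fin m)), B.componentSigma k := by
  refine iSup₂_le fun r hr => Measurable.comap_le ?_
  have h : Measurable[B.componentPast j t ⊔ ⨆ k ∈ ({j}ᶜ : Set (Fin m)), B.componentSigma k]
      (fun ω => (WithLp.ofLp (B.W r ω) : Fin m → ℝ)) := by
    refine @measurable_pi_lambda _ _ _ (_) _ _ fun k => ?_
    by_cases hk : k = j
    · subst hk
      have h0 : Measurable[B.componentPast k t] (fun ω => B.W r ω k) :=
        (measurable_pi_apply (⟨r, hr⟩ : Set.Iic t)).comp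
          (comap_measurable (fun ω (r : Set.Iic t) => B.W r ω k))
      exact h0.mono le_sup_left le_rfl
    · refine (B.measurable_component k r).mono (le_trans ?_ le_sup_right) le_rfl
      exact le_iSup₂_of_le (f := fun k (_ : k ∈ ({j}ᶜ : Set (Fin m))) => B.componentSigma k)
        k hk le_rfl
  exact (WithLp.measurable_toLp 2 (Fin m → ℝ)).comp h

theorem indep_brownian_increment_brownianPast (j : Fin m) {a b : ℝ≥0} (hab : a ≤ b) :
    Indep (MeasurableSpace.comap (fun ω => B.W b ω j - B.W a ω j) inferInstance)
      (B.brownianPast a) P := by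
  have hm : Measurable[B.componentSigma j] (fun ω => B.W b ω j - B.W a ω j) :=
    (B.measurable_component j b).sub (B.measurable_component j a)
  have hle : MeasurableSpace.comap (fun ω => B.W b ω j - B.W a ω j) inferInstance ≤
    B.componentSigma j := hm.comap_le
  have h₁ : Indep (MeasurableSpace.comap (fun ω => B.W b ω j - B.W a ω j) inferInstance)
      (B.componentPast j a) P := by
    have h := (B.brownian j).toIsPreBrownianReal.indepFun_shift a
    rw [IndepFun_iff_Indep] at h
    refine indep_of_indep_of_le_left h ?_
    have h0 := (measurable_pi_apply (b - a)).comp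
      (comap_measurable (fun ω (t : ℝ≥0) => B.W (a + t) ω j - B.W a ω j))
    simp only [Function.comp_def, add_tsub_cancel_of_le hab] at h0
    exact h0.comap_le
  have h₂ : Indep (B.componentSigma j) (⨆ k ∈ ({j}ᶜ : Set (Fin m)), B.componentSigma k) P := by
    have h := indep_iSup_of_disjoint (S := {j}) (T := {j}ᶜ) B.componentSigma_le
      B.indep_components.iIndep disjoint_compl_right
    simpa using h
  refine indep_of_indep_of_le_right (Indep.sup_right_of_sup_left
    (hle.trans (B.componentSigma_le j))
    ((B.componentPast_le_componentSigma j a).trans (B.componentSigma_le j))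
    (iSup₂_le fun k _ => B.componentSigma_le k) h₁ (indep_of_indep_of_le_left h₂
      (sup_le hle (B.componentPast_le_componentSigma j a)))) (B.brownianPast_le_components j a)

theorem brownianPast_le_iSup (t : ℝ≥0) :
    B.brownianPast t ≤ ⨆ t : ℝ≥0, MeasurableSpace.comap (B.W t) inferInstance :=
  iSup₂_le fun r _ => le_iSup (fun t => MeasurableSpace.comap (B.W t) inferInstance) r

/-- The σ-algebra generated by the Poisson random measure. -/
@[reducible] def poissonSigma : MeasurableSpace Ω :=
  ⨆ (A : Set (ℝ≥0 × Punctured d)) (_ : MeasurableSet A),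
    MeasurableSpace.comap (fun ω => B.N ω A) inferInstance

theorem comap_N_le_poissonSigma {C : Set (ℝ≥0 × Punctured d)} (hC : MeasurableSet C) :
    MeasurableSpace.comap (fun ω => B.N ω C) inferInstance ≤ B.poissonSigma :=
  le_iSup₂_of_le (f := fun A (_ : MeasurableSet A) =>
    MeasurableSpace.comap (fun ω => B.N ω A) inferInstance) C hC le_rfl

theorem poissonPast_le_poissonSigma (t : ℝ≥0) : B.poissonPast t ≤ B.poissonSigma :=
  iSup₂_le fun _ _ => iSup₂_le fun _ hA => B.comap_N_le_poissonSigma (measurableSet_Icc.prod hA)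

theorem indep_brownian_increment_rawSigma (j : Fin m) {a b : ℝ≥0} (hab : a ≤ b) :
    Indep (MeasurableSpace.comap (fun ω => B.W b ω j - B.W a ω j) inferInstance)
      (B.rawSigma a) P := by
  have hle : MeasurableSpace.comap (fun ω => B.W b ω j - B.W a ω j) inferInstance ≤
      ⨆ t : ℝ≥0, MeasurableSpace.comap (B.W t) inferInstance := by
    have h : ∀ t, Measurable[⨆ t : ℝ≥0, MeasurableSpace.comap (B.W t) inferInstance]
        (fun ω => B.W t ω j) := fun t =>
      (by fun_prop : Measurable fun x : Euc m => x j).comp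
        ((comap_measurable (B.W t)).mono
          (le_iSup (fun t => MeasurableSpace.comap (B.W t) inferInstance) t) le_rfl)
    exact ((h b).sub (h a)).comap_le
  refine Indep.sup_right_of_sup_left
    ((B.measurable_W_apply j b).sub (B.measurable_W_apply j a)).comap_le (B.brownianPast_le a)
    (B.poissonPast_le a) (B.indep_brownian_increment_brownianPast j hab) ?_
  exact indep_of_indep_of_le B.indep (sup_le hle (B.brownianPast_le_iSup a))
    (B.poissonPast_le_poissonSigma a)

end Noise

/-! ### Poisson random measures -/

section PoissonIndep

variable {E : Type*} [MeasurableSpace E] {N : Ω → Measure E} {μ : Measure E}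

theorem IsPoissonRandomMeasure.iIndepFun_of_finite (hN : IsPoissonRandomMeasure N μ P)
    {ι : Type*} [Finite ι] (A : ι → Set E) (hA : ∀ i, MeasurableSet (A i))
    (hd : Pairwise (fun i j => Disjoint (A i) (A j))) : iIndepFun (fun i ω => N ω (A i)) P := by
  obtain ⟨n, ⟨e⟩⟩ := Finite.exists_equiv_fin ι
  have h := hN.indep n (fun i => A (e.symm i)) (fun i => hA _)
    fun i j hij => hd (e.symm.injective.ne hij)
  have h' := h.precomp (g := e) e.injective
  simpa [Function.comp_def] using h'

/-- The points which, among the sets `A i` with `i ∈ F`, lie exactly in those with `i ∈ s`. -/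
def atom {ι : Type*} (A : ι → Set E) (s : Finset ι) (F : Finset ι) : Set E :=
  {x | ∀ i ∈ F, x ∈ A i ↔ i ∈ s}

/-- The masses of finitely many sets are jointly independent of the mass of a set disjoint from
all of them. -/
theorem IsPoissonRandomMeasure.indep_iSup_finset (hN : IsPoissonRandomMeasure N μ P)
    {ι : Type*} (A : ι → Set E) (hA : ∀ i, MeasurableSet (A i)) {C : Set E} (hC : MeasurableSet C)
    (hd : ∀ i, Disjoint (A i) C) (F : Finset ι) :
    Indep (⨆ i ∈ F, MeasurableSpace.comap (fun ω => N ω (A i)) inferInstance)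
      (MeasurableSpace.comap (fun ω => N ω C) inferInstance) P := by
  classical
  have hm : ∀ s, MeasurableSet (atom A s F) := fun s => by
    have : atom A s F = ⋂ i ∈ F, if i ∈ s then A i else (A i)ᶜ := by
      ext x
      simp only [atom, Set.mem_ofPred_eq, Set.mem_iInter]
      refine forall₂_congr fun i _ => ?_
      split_ifs with h <;> simp [h]
    rw [this]
    refine Finset.measurableSet_biInter _ fun i _ => ?_
    split_ifs
    exacts [hA i, (hA i).compl]
  -- Together with `C` the atoms form a finite disjoint family, hence have independent masses. `C`
  -- is removed because the atom of the empty index set may meet it.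
  let D : Option F.powerset → Set E := fun o => o.elim C fun s => atom A s.1 F \ C
  have hDm : ∀ o, MeasurableSet (D o) := by
    rintro (_ | s)
    exacts [hC, (hm _).diff hC]
  have hDd : Pairwise fun o o' => Disjoint (D o) (D o') := by
    rintro (_ | ⟨s, hs⟩) (_ | ⟨t, ht⟩) hst
    · exact absurd rfl hst
    · exact Set.disjoint_sdiff_right
    · exact Set.disjoint_sdiff_left
    · refine Set.disjoint_left.2 fun x hx hx' => hst ?_
      have : s = t := by
        ext i
        constructor
        · intro hi
          have hF := Finset.mem_powerset.1 hs hi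
          exact (hx'.1 i hF).1 ((hx.1 i hF).2 hi)
        · intro hi
          have hF := Finset.mem_powerset.1 ht hi
          exact (hx.1 i hF).1 ((hx'.1 i hF).2 hi)
      subst this
      rfl
  have hind := hN.iIndepFun_of_finite D hDm hDd
  have h := indep_iSup_of_disjoint (S := {none}ᶜ) (T := {none})
    (fun o => (hN.measurable _ (hDm o)).comap_le) hind.iIndep disjoint_compl_left
  simp only [Set.mem_singleton_iff, iSup_iSup_eq_left] at h
  refine indep_of_indep_of_le_left h (iSup₂_le fun i hi => Measurable.comap_le ?_)
  have hsum : (fun ω => N ω (A i)) =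
      fun ω => ∑ s : F.powerset, if i ∈ s.1 then N ω (D (some s)) else 0 := by
    funext ω
    rw [← Finset.sum_filter, ← measure_biUnion_finset
      (fun s _ t _ hst => hDd (fun h => hst (Option.some_injective _ h))) (fun s _ => hDm _)]
    congr 1
    ext x
    simp only [Set.mem_iUnion, Finset.mem_filter, Finset.mem_univ, true_and, exists_prop]
    constructor
    · intro hx
      -- The atom containing `x` is indexed by all `k ∈ F` with `x ∈ A k`.
      refine ⟨⟨F.filter fun k => x ∈ A k, Finset.mem_powerset.2 (Finset.filter_subset _ _)⟩,
        by simp [hi, hx], fun k hk => by simp [hk], Set.disjoint_left.1 (hd i) hx⟩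
    · rintro ⟨s, hs, hx⟩
      exact (hx.1 i hi).2 hs
  rw [hsum]
  refine Finset.measurable_sum _ fun s _ => ?_
  split_ifs
  · exact (comap_measurable _).mono (le_iSup₂_of_le (f := fun o (_ : o ∈ ({none}ᶜ : Set _)) =>
      MeasurableSpace.comap (fun ω => N ω (D o)) inferInstance) (some s) (by simp) le_rfl) le_rfl
  · exact measurable_const

/-- The σ-algebra of an arbitrary family is the directed supremum of those of its finite
subfamilies, and independence passes to directed suprema. -/
theorem IsPoissonRandomMeasure.indep_iSup (hN : IsPoissonRandomMeasure N μ P)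
    {ι : Type*} (A : ι → Set E) (hA : ∀ i, MeasurableSet (A i)) {C : Set E} (hC : MeasurableSet C)
    (hd : ∀ i, Disjoint (A i) C) :
    Indep (⨆ i, MeasurableSpace.comap (fun ω => N ω (A i)) inferInstance)
      (MeasurableSpace.comap (fun ω => N ω C) inferInstance) P := by
  rw [iSup_eq_iSup_finset]
  refine indep_iSup_of_directed_le (hN.indep_iSup_finset A hA hC hd)
    (fun F => iSup₂_le fun i _ => (hN.measurable _ (hA i)).comap_le)
    (hN.measurable _ hC).comap_le (Monotone.directed_le fun F G hFG => ?_)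
  exact biSup_mono fun i hi => hFG hi

end PoissonIndep

namespace Noise

variable {m d : ℕ} {ν : Measure (Punctured d)} (B : Noise P m ν)

/-- Every set `[0,r] × A'` with `r ≤ a` is disjoint from `(a,b] × A`; the Brownian past is then
adjoined through the independence of `W` and `N`. -/
theorem indep_poisson_increment_rawSigma {a b : ℝ≥0} {A : Set (Punctured d)}
    (hA : MeasurableSet A) :
    Indep (MeasurableSpace.comap (fun ω => B.N ω (Set.Ioc a b ×ˢ A)) inferInstance)
      (B.rawSigma a) P := by
  have hC : MeasurableSet (Set.Ioc a b ×ˢ A) := measurableSet_Ioc.prod hA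
  have h := B.poisson.indep_iSup
    (ι := {p : ℝ≥0 × Set (Punctured d) // p.1 ≤ a ∧ MeasurableSet p.2})
    (fun i => Set.Icc 0 i.1.1 ×ˢ i.1.2) (fun i => measurableSet_Icc.prod i.2.2) hC
    (fun i => Set.disjoint_left.2 fun x hx hx' => (hx.1.2.trans i.2.1).not_gt hx'.1.1)
  have h₁ : Indep (MeasurableSpace.comap (fun ω => B.N ω (Set.Ioc a b ×ˢ A)) inferInstance)
      (B.poissonPast a) P := by
    refine indep_of_indep_of_le_right h.symm ?_
    refine iSup₂_le fun r hr => iSup₂_le fun A' hA' => ?_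
    exact le_iSup (fun i : {p : ℝ≥0 × Set (Punctured d) // p.1 ≤ a ∧ MeasurableSet p.2} =>
      MeasurableSpace.comap (fun ω => B.N ω (Set.Icc 0 i.1.1 ×ˢ i.1.2)) inferInstance)
      ⟨(r, A'), hr, hA'⟩
  have h₂ := Indep.sup_right_of_sup_left (B.measurable_N hC).comap_le (B.poissonPast_le a)
    (B.brownianPast_le a) h₁ (indep_of_indep_of_le B.indep.symm
      (sup_le (B.comap_N_le_poissonSigma hC) (B.poissonPast_le_poissonSigma a))
      (B.brownianPast_le_iSup a))
  rwa [sup_comm] at h₂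

end Noise

end

/-! ### Moments of the noise and orthogonality of increments to the past. -/

section

/-! ### Lebesgue measure on the half-line -/

theorem measurableEmbedding_coe_nnreal : MeasurableEmbedding (fun t : ℝ≥0 => (t : ℝ)) :=
  MeasurableEmbedding.subtype_coe measurableSet_Ici

theorem leb_apply (s : Set ℝ≥0) : leb s = volume ((fun t : ℝ≥0 => (t : ℝ)) '' s) :=
  measurableEmbedding_coe_nnreal.comap_apply _ _

theorem image_coe_nnreal_Ioc (a b : ℝ≥0) :
    (fun t : ℝ≥0 => (t : ℝ)) '' Set.Ioc a b = Set.Ioc (a : ℝ) b := by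
  ext x
  constructor
  · rintro ⟨t, ht, rfl⟩
    exact ⟨NNReal.coe_lt_coe.2 ht.1, NNReal.coe_le_coe.2 ht.2⟩
  · intro hx
    exact ⟨⟨x, a.2.trans hx.1.le⟩, ⟨hx.1, hx.2⟩, rfl⟩

theorem leb_Ioc (a b : ℝ≥0) : leb (Set.Ioc a b) = ENNReal.ofReal ((b : ℝ) - a) := by
  rw [leb_apply, image_coe_nnreal_Ioc, Real.volume_Ioc]

theorem leb_singleton (a : ℝ≥0) : leb {a} = 0 := by
  rw [leb_apply, Set.image_singleton, Real.volume_singleton]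

instance : SigmaFinite leb := by
  refine ⟨⟨⟨fun n => {0} ∪ Set.Ioc 0 n, fun _ => trivial, fun n => ?_, ?_⟩⟩⟩
  · refine (measure_union_le {0} _).trans_lt ?_
    rw [leb_singleton, leb_Ioc, zero_add]
    exact ENNReal.ofReal_lt_top
  · refine Set.eq_univ_of_forall fun t => ?_
    obtain ⟨n, hn⟩ := exists_nat_ge t
    rcases eq_or_ne t 0 with rfl | ht
    · exact Set.mem_iUnion.2 ⟨0, .inl rfl⟩
    · exact Set.mem_iUnion.2 ⟨n, .inr ⟨pos_iff_ne_zero.2 ht, hn⟩⟩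

variable {Ω : Type*} [mΩ : MeasurableSpace Ω] {P : Measure Ω} [IsProbabilityMeasure P]

/-! ### Moments of the increments of the noise -/

/-- Since `n rⁿ / n! = r · rⁿ⁻¹ / (n - 1)!`, dropping the zero term at `n = 0` and shifting leaves
`r` times the total mass. -/
theorem hasSum_mean_poisson (r : ℝ≥0) :
    HasSum (fun n : ℕ => Real.exp (-r) * (r : ℝ) ^ n / (n.factorial : ℝ) * (n : ℝ)) r := by
  have h := (hasSum_one_poissonMeasure r).mul_left (r : ℝ)
  rw [mul_one] at h
  refine (hasSum_nat_add_iff' 1).1 ?_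
  simp only [Finset.range_one, Finset.sum_singleton, Nat.cast_zero, mul_zero, sub_zero]
  have heq : (fun n : ℕ => Real.exp (-r) * (r : ℝ) ^ (n + 1) / ((n + 1).factorial : ℝ) *
      ((n + 1 : ℕ) : ℝ)) = fun n => r * (Real.exp (-r) * (r : ℝ) ^ n / (n.factorial : ℝ)) := by
    funext n
    rw [Nat.factorial_succ]
    push_cast
    have : (n.factorial : ℝ) ≠ 0 := by positivity
    field_simp
    ring
  rw [heq]
  exact h

theorem integrable_id_poissonMeasure (r : ℝ≥0) :
    Integrable (fun n : ℕ => (n : ℝ)) (poissonMeasure r) := by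
  rw [integrable_poissonMeasure_iff]
  simpa using (hasSum_mean_poisson r).summable

theorem integral_id_poissonMeasure (r : ℝ≥0) : ∫ n : ℕ, (n : ℝ) ∂(poissonMeasure r) = r := by
  rw [integral_poissonMeasure]
  simpa using (hasSum_mean_poisson r).tsum_eq

section Poisson

variable {E : Type*} [MeasurableSpace E] {N : Ω → Measure E} {μ : Measure E}

theorem IsPoissonRandomMeasure.ae_lt_top (hN : IsPoissonRandomMeasure N μ P) {C : Set E}
    (hC : MeasurableSet C) (h : μ C ≠ ∞) : ∀ᵐ ω ∂P, N ω C < ∞ := by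
  have h1 : ∀ᵐ x ∂(P.map fun ω => N ω C), x < ∞ := by
    rw [hN.law C hC h, ae_map_iff (by fun_prop) measurableSet_Iio]
    exact .of_forall fun n => ENNReal.natCast_lt_top n
  exact ae_of_ae_map (hN.measurable C hC).aemeasurable h1

theorem IsPoissonRandomMeasure.integrable (hN : IsPoissonRandomMeasure N μ P) {C : Set E}
    (hC : MeasurableSet C) (h : μ C ≠ ∞) : Integrable (fun ω => (N ω C).toReal) P := by
  have h1 : Integrable (fun x : ℝ≥0∞ => x.toReal) (P.map fun ω => N ω C) := by
    rw [hN.law C hC h, integrable_map_measure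
      ENNReal.measurable_toReal.aestronglyMeasurable (by fun_prop)]
    simpa [Function.comp_def] using integrable_id_poissonMeasure _
  exact h1.comp_measurable (hN.measurable C hC)

theorem IsPoissonRandomMeasure.integral_eq (hN : IsPoissonRandomMeasure N μ P) {C : Set E}
    (hC : MeasurableSet C) (h : μ C ≠ ∞) : ∫ ω, (N ω C).toReal ∂P = (μ C).toReal := by
  rw [← integral_map (φ := fun ω => N ω C) (f := fun x : ℝ≥0∞ => x.toReal)
    (hN.measurable C hC).aemeasurable ENNReal.measurable_toReal.aestronglyMeasurable,
    hN.law C hC h, integral_map (by fun_prop) ENNReal.measurable_toReal.aestronglyMeasurable]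
  simp only [ENNReal.toReal_natCast]
  exact integral_id_poissonMeasure _

end Poisson

/-- This is nonnegativity of the variance of `|X|`. -/
theorem integral_abs_le_sqrt {X : Ω → ℝ} (hX : MemLp X 2 P) :
    ∫ ω, |X ω| ∂P ≤ √(∫ ω, X ω ^ 2 ∂P) := by
  refine Real.le_sqrt_of_sq_le ?_
  have h := variance_eq_sub (μ := P) (X := fun ω => |X ω|) hX.abs
  have h0 := variance_nonneg (fun ω => |X ω|) P
  simp only [Pi.pow_apply, sq_abs] at h
  linarith

/-! ### Processes with centered increments -/

/-- The increments of `M` after time `a` are integrable and orthogonal to `𝓕 a`. -/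
structure CenteredIncrements (𝓕 : Filtration ℝ≥0 mΩ) (P : Measure Ω) (M : ℝ≥0 → Ω → ℝ) :
    Prop where
  integrable : ∀ a b, a ≤ b → Integrable (fun ω => M b ω - M a ω) P
  setIntegral : ∀ a b, a ≤ b → ∀ A, MeasurableSet[𝓕 a] A → ∫ ω in A, (M b ω - M a ω) ∂P = 0

variable {𝓕 : Filtration ℝ≥0 mΩ}

theorem CenteredIncrements.condExp {M : ℝ≥0 → Ω → ℝ} (hM : CenteredIncrements 𝓕 P M) {a b : ℝ≥0}
    (hab : a ≤ b) : P[fun ω => M b ω - M a ω | 𝓕 a] =ᵐ[P] 0 := by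
  refine (ae_eq_condExp_of_forall_setIntegral_eq (𝓕.le a) (hM.integrable a b hab)
    (fun _ _ _ => (integrable_zero _ _ _).integrableOn) (fun A hA _ => ?_)
    stronglyMeasurable_zero.aestronglyMeasurable).symm
  simp [hM.setIntegral a b hab A hA]

theorem CenteredIncrements.setIntegral_mul {M : ℝ≥0 → Ω → ℝ} (hM : CenteredIncrements 𝓕 P M)
    {a b : ℝ≥0} (hab : a ≤ b) {ξ : Ω → ℝ} (hξ : Measurable[𝓕 a] ξ) {C : ℝ} (hC : ∀ ω, |ξ ω| ≤ C)
    {A : Set Ω} (hA : MeasurableSet[𝓕 a] A) :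
    Integrable (fun ω => ξ ω * (M b ω - M a ω)) P ∧ ∫ ω in A, ξ ω * (M b ω - M a ω) ∂P = 0 := by
  have hint : Integrable (fun ω => ξ ω * (M b ω - M a ω)) P :=
    (hM.integrable a b hab).bdd_mul (c := C)
      (hξ.mono (𝓕.le a) le_rfl).aestronglyMeasurable (.of_forall hC)
  refine ⟨hint, ?_⟩
  rw [← setIntegral_condExp (𝓕.le a) hint hA]
  have h := condExp_mul_of_stronglyMeasurable_left (μ := P) (m := 𝓕 a) hξ.stronglyMeasurable hint
    (hM.integrable a b hab)
  rw [setIntegral_congr_ae (g := fun _ => 0) (𝓕.le a _ hA)]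
  · simp
  · filter_upwards [h, hM.condExp hab] with ω h1 h2 _
    have h1' : (P[fun ω => ξ ω * (M b ω - M a ω) | 𝓕 a]) ω =
      ξ ω * (P[fun ω => M b ω - M a ω | 𝓕 a]) ω := h1
    rw [h1', h2, Pi.zero_apply, mul_zero]

theorem CenteredIncrements.sum {ι : Type*} (s : Finset ι) {M : ι → ℝ≥0 → Ω → ℝ}
    (hM : ∀ i ∈ s, CenteredIncrements 𝓕 P (M i)) :
    CenteredIncrements 𝓕 P (fun t ω => ∑ i ∈ s, M i t ω) where
  integrable a b hab := by
    simp only [← Finset.sum_sub_distrib]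
    exact integrable_finsetSum _ fun i hi => (hM i hi).integrable a b hab
  setIntegral a b hab A hA := by
    simp only [← Finset.sum_sub_distrib]
    rw [integral_finsetSum _ fun i hi => ((hM i hi).integrable a b hab).integrableOn]
    exact Finset.sum_eq_zero fun i hi => (hM i hi).setIntegral a b hab A hA

theorem CenteredIncrements.add {M M' : ℝ≥0 → Ω → ℝ} (hM : CenteredIncrements 𝓕 P M)
    (hM' : CenteredIncrements 𝓕 P M') : CenteredIncrements 𝓕 P (fun t ω => M t ω + M' t ω) where
  integrable a b hab := by
    simp only [add_sub_add_comm]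
    exact (hM.integrable a b hab).add (hM'.integrable a b hab)
  setIntegral a b hab A hA := by
    simp only [add_sub_add_comm]
    rw [integral_add (hM.integrable a b hab).integrableOn (hM'.integrable a b hab).integrableOn,
      hM.setIntegral a b hab A hA, hM'.setIntegral a b hab A hA, add_zero]

theorem CenteredIncrements.congr {M M' : ℝ≥0 → Ω → ℝ} (hM : CenteredIncrements 𝓕 P M)
    (h : ∀ t, M t =ᵐ[P] M' t) : CenteredIncrements 𝓕 P M' where
  integrable a b hab := (hM.integrable a b hab).congr ((h b).sub (h a))
  setIntegral a b hab A hA := by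
    rw [← hM.setIntegral a b hab A hA]
    refine setIntegral_congr_ae (𝓕.le a _ hA) ?_
    filter_upwards [h a, h b] with ω h1 h2 _
    rw [h1, h2]

/-- The elementary stochastic integral of `ξ 1_{(s,t]}`. -/
theorem CenteredIncrements.transform {M : ℝ≥0 → Ω → ℝ} (hM : CenteredIncrements 𝓕 P M)
    {s t : ℝ≥0} (hst : s ≤ t) {ξ : Ω → ℝ} (hξ : Measurable[𝓕 s] ξ) {C : ℝ}
    (hC : ∀ ω, |ξ ω| ≤ C) :
    CenteredIncrements 𝓕 P (fun r ω => ξ ω * (M (min t r) ω - M (min s r) ω)) := by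
  -- The increment of the transform over `(a,b]` is `ξ` times that of `M` over `(a,b] ∩ (s,t]`. An
  -- empty intersection is encoded by `a' = b' = 0`; otherwise the left end is past both `a` and
  -- `s`, so both `A` and `ξ` are known there.
  have key : ∀ a b, a ≤ b → ∃ a' b',
      (∀ ω, ξ ω * (M (min t b) ω - M (min s b) ω) - ξ ω * (M (min t a) ω - M (min s a) ω) =
        ξ ω * (M b' ω - M a' ω)) ∧ a' ≤ b' ∧ (a' = b' ∨ (a ≤ a' ∧ s ≤ a')) := by
    intro a b hab
    rcases le_total b s with hbs | hsb
    · refine ⟨0, 0, fun ω => ?_, le_rfl, .inl rfl⟩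
      rw [min_eq_right (hbs.trans hst), min_eq_right hbs, min_eq_right (hab.trans (hbs.trans hst)),
        min_eq_right (hab.trans hbs)]
      ring
    · rcases le_total a s with has | hsa
      · refine ⟨s, min t b, fun ω => ?_, le_min hst hsb,
          .inr ⟨has, le_rfl⟩⟩
        rw [min_eq_left hsb, min_eq_right has, min_eq_right (has.trans hst)]
        ring
      · rcases le_total a t with hat | hta
        · refine ⟨a, min t b, fun ω => ?_, le_min hat hab,
            .inr ⟨le_rfl, hsa⟩⟩
          rw [min_eq_left hsb, min_eq_left hsa, min_eq_right hat]
          ring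
        · refine ⟨0, 0, fun ω => ?_, le_rfl, .inl rfl⟩
          rw [min_eq_left hsb, min_eq_left hsa, min_eq_left hta, min_eq_left (hta.trans hab)]
          ring
  constructor
  · intro a b hab
    obtain ⟨a', b', h, hab', rfl | ⟨ha, hs⟩⟩ := key a b hab
    · simp [h]
    · simp only [h]
      exact (hM.setIntegral_mul hab' (hξ.mono (𝓕.mono hs) le_rfl) hC MeasurableSet.univ).1
  · intro a b hab A hA
    obtain ⟨a', b', h, hab', rfl | ⟨ha, hs⟩⟩ := key a b hab
    · simp [h]
    · simp only [h]
      exact (hM.setIntegral_mul hab' (hξ.mono (𝓕.mono hs) le_rfl) hC (𝓕.mono ha _ hA)).2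

/-- Limits in `L¹` of processes with centered increments have centered increments. -/
theorem CenteredIncrements.of_tendsto {H : ℕ → ℝ≥0 → Ω → ℝ} {M : ℝ≥0 → Ω → ℝ}
    (hH : ∀ k, CenteredIncrements 𝓕 P (H k)) (hHm : ∀ k t, AEStronglyMeasurable (H k t) P)
    (hm : ∀ t, AEStronglyMeasurable (M t) P)
    (h : ∀ t, Tendsto (fun k => eLpNorm (fun ω => H k t ω - M t ω) 1 P) atTop (𝓝 0)) :
    CenteredIncrements 𝓕 P M := by
  have hdiff : ∀ a b, Tendsto (fun k => eLpNorm
      ((fun ω => H k b ω - H k a ω) - fun ω => M b ω - M a ω) 1 P) atTop (𝓝 0) := by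
    intro a b
    have h0 := (h b).add (h a)
    rw [add_zero] at h0
    refine tendsto_of_tendsto_of_tendsto_of_le_of_le tendsto_const_nhds h0 (fun _ => zero_le)
      fun k => ?_
    have := eLpNorm_sub_le (μ := P) (p := 1) ((hHm k b).sub (hm b)) ((hHm k a).sub (hm a)) le_rfl
    refine le_trans (le_of_eq ?_) this
    congr 1
    ext ω
    simp only [Pi.sub_apply]
    ring
  have hint : ∀ a b, a ≤ b → Integrable (fun ω => M b ω - M a ω) P := by
    intro a b hab
    obtain ⟨k, hk⟩ := ((hdiff a b).eventually (gt_mem_nhds zero_lt_one)).exists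
    have h1 : MemLp ((fun ω => H k b ω - H k a ω) - fun ω => M b ω - M a ω) 1 P :=
      ⟨((hHm k b).sub (hHm k a)).sub ((hm b).sub (hm a)), hk.trans ENNReal.one_lt_top⟩
    have h2 := ((hH k).integrable a b hab).sub (memLp_one_iff_integrable.1 h1)
    refine h2.congr (.of_forall fun ω => ?_)
    simp
  refine ⟨hint, fun a b hab A hA => ?_⟩
  have h1 := tendsto_setIntegral_of_L1' (fun ω => M b ω - M a ω) (hint a b hab).1
    (.of_forall fun k => (hH k).integrable a b hab) (hdiff a b) A
  refine tendsto_nhds_unique h1 ?_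
  exact tendsto_const_nhds.congr fun k => ((hH k).setIntegral a b hab A hA).symm

theorem CenteredIncrements.martingale {M : ℝ≥0 → Ω → ℝ} (hM : CenteredIncrements 𝓕 P M)
    (hadapted : ∀ t, Measurable[𝓕 t] (M t)) (hint : ∀ t, Integrable (M t) P) :
    Martingale M 𝓕 P := by
  refine ⟨fun t => (hadapted t).stronglyMeasurable, fun a b hab => ?_⟩
  have h := condExp_sub (hint b) (hint a) (𝓕 a)
  rw [condExp_of_stronglyMeasurable (𝓕.le a) (hadapted a).stronglyMeasurable (hint a)] at h
  filter_upwards [h, hM.condExp hab] with ω h1 h2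
  have h1' : (P[fun ω => M b ω - M a ω | 𝓕 a]) ω = (P[M b | 𝓕 a]) ω - M a ω := h1
  rw [h2, Pi.zero_apply] at h1'
  linarith

theorem CenteredIncrements.comp_min {M : ℝ≥0 → Ω → ℝ} (hM : CenteredIncrements 𝓕 P M)
    (T : ℝ≥0) : CenteredIncrements 𝓕 P (fun t => M (min t T)) := by
  constructor
  · intro a b hab
    exact hM.integrable _ _ (min_le_min_right T hab)
  · intro a b hab A hA
    rcases le_total a T with h | h
    · have := hM.setIntegral a (min b T) (le_min hab h) A hA
      simpa [min_eq_left h] using this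
    · simp [min_eq_right h, min_eq_right (h.trans hab)]

/-! ### The noise has centered increments in the augmented filtration. -/

namespace Noise

variable {m d : ℕ} {ν : Measure (Punctured d)} (B : Noise P m ν)

/-- Augmentation adds only null sets to the right limit of the raw filtration: up to a null set,
each event of `B.filtration a` is in `B.rawSigma s` for all `s > a`. -/
theorem filtration_le_eventuallyMeasurableSpace (a : ℝ≥0) :
    B.filtration a ≤ eventuallyMeasurableSpace (⨅ (s : ℝ≥0) (_ : a < s), B.rawSigma s) (ae P) := by
  refine sup_le (sup_le ?_ le_eventuallyMeasurableSpace) ?_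
  · exact (le_iInf₂ fun s hs => B.rawSigma_mono hs.le).trans le_eventuallyMeasurableSpace
  · refine MeasurableSpace.generateFrom_le fun A hA => ?_
    exact ⟨∅, @MeasurableSet.empty _ (_), ae_eq_empty.2 hA.2⟩

/-- If the increments of `M` are orthogonal to the past in the raw filtration and `M` is
right-continuous in `L¹`, then the increments are orthogonal to the augmented past. -/
theorem centeredIncrements {M : ℝ≥0 → Ω → ℝ}
    (hint : ∀ a b, a ≤ b → Integrable (fun ω => M b ω - M a ω) P)
    (hraw : ∀ a b, a ≤ b → ∀ A, MeasurableSet[B.rawSigma a] A →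
      ∫ ω in A, (M b ω - M a ω) ∂P = 0)
    (hright : ∀ a, Tendsto (fun b => ∫ ω, |M b ω - M a ω| ∂P) (𝓝[>] a) (𝓝 0)) :
    CenteredIncrements B.filtration P M := by
  refine ⟨hint, fun a b hab A hA => ?_⟩
  rcases hab.eq_or_lt with rfl | hab
  · simp
  obtain ⟨A', hA', hAA'⟩ := B.filtration_le_eventuallyMeasurableSpace a A hA
  rw [setIntegral_congr_set hAA']
  -- For `a < s < b` the event `A'` is in the raw past of `s`, so the increment over `(s,b]`
  -- integrates to zero over it. What remains is at most `E|M_s - M_a|`, which vanishes as `s`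
  -- decreases to `a`.
  refine tendsto_nhds_unique (tendsto_const_nhds (f := 𝓝[>] a)) (squeeze_zero_norm' ?_ (hright a))
  filter_upwards [Ioo_mem_nhdsGT hab] with s hs
  have hs' : MeasurableSet[B.rawSigma s] A' :=
    (iInf₂_le (f := fun s (_ : a < s) => B.rawSigma s) s hs.1) A' hA'
  have heq : ∫ ω in A', (M b ω - M a ω) ∂P = ∫ ω in A', (M s ω - M a ω) ∂P := by
    rw [← sub_eq_zero, ← integral_sub (hint a b hab.le).integrableOn
      (hint a s hs.1.le).integrableOn, ← hraw s b hs.2.le A' hs']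
    congr 1
    ext ω
    ring
  rw [heq]
  refine (norm_integral_le_integral_norm _).trans ?_
  exact setIntegral_le_integral (hint a s hs.1.le).abs (.of_forall fun ω => abs_nonneg _)

theorem setIntegral_eq_zero_of_indep {m₁ m₂ : MeasurableSpace Ω} (h₁ : m₁ ≤ mΩ) (h₂ : m₂ ≤ mΩ)
    (h : Indep m₁ m₂ P) {X : Ω → ℝ} (hX : Measurable[m₁] X) (hint : Integrable X P)
    (h0 : ∫ ω, X ω ∂P = 0) {A : Set Ω} (hA : MeasurableSet[m₂] A) : ∫ ω in A, X ω ∂P = 0 := by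
  rw [← setIntegral_condExp h₂ hint hA, setIntegral_congr_ae (g := fun _ => 0) (h₂ _ hA)]
  · simp
  · filter_upwards [condExp_indep_eq h₁ h₂ hX.stronglyMeasurable h] with ω hω _
    rw [hω, h0]

theorem memLp_brownian_increment (j : Fin m) (a b : ℝ≥0) :
    MemLp (fun ω => B.W b ω j - B.W a ω j) 2 P :=
  ((B.brownian j).toIsPreBrownianReal.hasLaw_sub b a).hasGaussianLaw.memLp_two

theorem integral_brownian_increment (j : Fin m) (a b : ℝ≥0) :
    ∫ ω, (B.W b ω j - B.W a ω j) ∂P = 0 := by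
  have h := ((B.brownian j).toIsPreBrownianReal.hasLaw_sub b a).integral_eq
  rw [integral_id_gaussianReal] at h
  exact h

theorem integral_sq_brownian_increment (j : Fin m) {a b : ℝ≥0} (hab : a ≤ b) :
    ∫ ω, (B.W b ω j - B.W a ω j) ^ 2 ∂P = (b : ℝ) - a := by
  rw [← variance_of_integral_eq_zero (B.memLp_brownian_increment j a b).1.aemeasurable
    (B.integral_brownian_increment j a b)]
  have h := ((B.brownian j).toIsPreBrownianReal.hasLaw_sub b a).variance_eq
  rw [variance_id_gaussianReal] at h
  refine h.trans ?_
  rw [coe_nndist, Real.dist_eq]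
  exact abs_of_nonneg (sub_nonneg.2 (NNReal.coe_le_coe.2 hab))

theorem centeredIncrements_brownian (j : Fin m) :
    CenteredIncrements B.filtration P (fun t ω => B.W t ω j) := by
  refine B.centeredIncrements
    (fun a b _ => (B.memLp_brownian_increment j a b).integrable one_le_two)
    (fun a b hab A hA => ?_) fun a => ?_
  · refine setIntegral_eq_zero_of_indep
      ((B.measurable_W_apply j b).sub (B.measurable_W_apply j a)).comap_le (B.rawSigma_le a)
      (B.indep_brownian_increment_rawSigma j hab) (comap_measurable _)
      ((B.memLp_brownian_increment j a b).integrable one_le_two)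
      (B.integral_brownian_increment j a b) hA
  · have h : Tendsto (fun b : ℝ≥0 => √((b : ℝ) - a)) (𝓝[>] a) (𝓝 0) := by
      have : Continuous (fun b : ℝ≥0 => √((b : ℝ) - a)) := by fun_prop
      simpa using (this.tendsto a).mono_left nhdsWithin_le_nhds
    refine squeeze_zero' (.of_forall fun b => integral_nonneg fun ω => abs_nonneg _) ?_ h
    filter_upwards [self_mem_nhdsWithin] with b hb
    rw [← B.integral_sq_brownian_increment j (le_of_lt hb)]
    exact integral_abs_le_sqrt (B.memLp_brownian_increment j a b)

variable [SigmaFinite ν]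

theorem intensity_Ioc_prod (a b : ℝ≥0) (A : Set (Punctured d)) :
    (leb.prod ν) (Set.Ioc a b ×ˢ A) = ENNReal.ofReal ((b : ℝ) - a) * ν A := by
  rw [Measure.prod_prod, leb_Ioc]

theorem integrable_compensated (a b : ℝ≥0) {A : Set (Punctured d)} (hA : MeasurableSet A)
    (hfin : ν A ≠ ∞) : Integrable (B.compensated a b A) P := by
  refine (B.poisson.integrable (measurableSet_Ioc.prod hA) ?_).sub (integrable_const _)
  rw [intensity_Ioc_prod]
  exact ENNReal.mul_ne_top ENNReal.ofReal_ne_top hfin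

theorem integral_compensated {a b : ℝ≥0} (hab : a ≤ b) {A : Set (Punctured d)}
    (hA : MeasurableSet A) (hfin : ν A ≠ ∞) : ∫ ω, B.compensated a b A ω ∂P = 0 := by
  have h : (leb.prod ν) (Set.Ioc a b ×ˢ A) ≠ ∞ := by
    rw [intensity_Ioc_prod]
    exact ENNReal.mul_ne_top ENNReal.ofReal_ne_top hfin
  unfold compensated
  rw [integral_sub (B.poisson.integrable (measurableSet_Ioc.prod hA) h) (integrable_const _),
    B.poisson.integral_eq (measurableSet_Ioc.prod hA) h, intensity_Ioc_prod, ENNReal.toReal_mul,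
    ENNReal.toReal_ofReal (sub_nonneg.2 (NNReal.coe_le_coe.2 hab))]
  simp

/-- The triangle inequality suffices, as the count and its compensator have the same mean; the bound
serves only for right-continuity in `L¹`. -/
theorem integral_abs_compensated_le {a b : ℝ≥0} (hab : a ≤ b) {A : Set (Punctured d)}
    (hA : MeasurableSet A) (hfin : ν A ≠ ∞) :
    ∫ ω, |B.compensated a b A ω| ∂P ≤ 2 * (((b : ℝ) - a) * (ν A).toReal) := by
  have h : (leb.prod ν) (Set.Ioc a b ×ˢ A) ≠ ∞ := by
    rw [intensity_Ioc_prod]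
    exact ENNReal.mul_ne_top ENNReal.ofReal_ne_top hfin
  have h0 : 0 ≤ ((b : ℝ) - a) * (ν A).toReal :=
    mul_nonneg (sub_nonneg.2 (NNReal.coe_le_coe.2 hab)) ENNReal.toReal_nonneg
  have hi := B.poisson.integrable (measurableSet_Ioc.prod hA) h
  calc ∫ ω, |B.compensated a b A ω| ∂P
      ≤ ∫ ω, ((B.N ω (Set.Ioc a b ×ˢ A)).toReal + ((b : ℝ) - a) * (ν A).toReal) ∂P := by
        refine integral_mono (B.integrable_compensated a b hA hfin).abs
          (hi.add (integrable_const _)) fun ω => ?_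
        refine (abs_sub _ _).trans (le_of_eq ?_)
        rw [abs_of_nonneg ENNReal.toReal_nonneg, abs_of_nonneg h0]
    _ = 2 * (((b : ℝ) - a) * (ν A).toReal) := by
        rw [integral_add hi (integrable_const _),
          B.poisson.integral_eq (measurableSet_Ioc.prod hA) h, intensity_Ioc_prod,
          ENNReal.toReal_mul, ENNReal.toReal_ofReal (sub_nonneg.2 (NNReal.coe_le_coe.2 hab))]
        simp
        ring

/-- Only almost sure: `ENNReal.toReal` sends `∞` to `0`, so additivity can fail where the random
measure is infinite. -/
theorem compensated_ae_eq_sub {a b : ℝ≥0} (hab : a ≤ b) {A : Set (Punctured d)}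
    (hA : MeasurableSet A) (hfin : ν A ≠ ∞) :
    ∀ᵐ ω ∂P, B.compensated a b A ω = B.compensated 0 b A ω - B.compensated 0 a A ω := by
  have h : ∀ a b : ℝ≥0, (leb.prod ν) (Set.Ioc a b ×ˢ A) ≠ ∞ := fun a b => by
    rw [intensity_Ioc_prod]
    exact ENNReal.mul_ne_top ENNReal.ofReal_ne_top hfin
  filter_upwards [B.poisson.ae_lt_top (measurableSet_Ioc.prod hA) (h 0 a),
    B.poisson.ae_lt_top (measurableSet_Ioc.prod hA) (h a b)] with ω h1 h2
  have h3 : B.N ω (Set.Ioc 0 b ×ˢ A) =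
      B.N ω (Set.Ioc 0 a ×ˢ A) + B.N ω (Set.Ioc a b ×ˢ A) := by
    rw [← measure_union _ (measurableSet_Ioc.prod hA), ← Set.union_prod,
      Set.Ioc_union_Ioc_eq_Ioc zero_le hab]
    exact Set.disjoint_left.2 fun x hx hx' => hx.1.2.not_gt hx'.1.1
  unfold compensated
  rw [h3, ENNReal.toReal_add h1.ne h2.ne]
  simp only [NNReal.coe_zero]
  ring

theorem centeredIncrements_compensated {A : Set (Punctured d)} (hA : MeasurableSet A)
    (hfin : ν A ≠ ∞) : CenteredIncrements B.filtration P (fun t => B.compensated 0 t A) := by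
  refine B.centeredIncrements (fun a b _ => (B.integrable_compensated 0 b hA hfin).sub
    (B.integrable_compensated 0 a hA hfin)) (fun a b hab F hF => ?_) fun a => ?_
  · have hm : Measurable[MeasurableSpace.comap (fun ω => B.N ω (Set.Ioc a b ×ˢ A)) inferInstance]
        (B.compensated a b A) :=
      (ENNReal.measurable_toReal.comp (comap_measurable _)).sub_const _
    rw [← setIntegral_eq_zero_of_indep (B.measurable_N (measurableSet_Ioc.prod hA)).comap_le
      (B.rawSigma_le a) (B.indep_poisson_increment_rawSigma hA) hm
      (B.integrable_compensated a b hA hfin) (B.integral_compensated hab hA hfin) hF]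
    refine setIntegral_congr_ae (B.rawSigma_le a _ hF) ?_
    filter_upwards [B.compensated_ae_eq_sub hab hA hfin] with ω hω _ using hω.symm
  · have h : Tendsto (fun b : ℝ≥0 => 2 * (((b : ℝ) - a) * (ν A).toReal)) (𝓝[>] a) (𝓝 0) := by
      have : Continuous (fun b : ℝ≥0 => 2 * (((b : ℝ) - a) * (ν A).toReal)) := by fun_prop
      simpa using (this.tendsto a).mono_left nhdsWithin_le_nhds
    refine squeeze_zero' (.of_forall fun b => integral_nonneg fun ω => abs_nonneg _) ?_ h
    filter_upwards [self_mem_nhdsWithin] with b hb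
    refine le_trans (le_of_eq ?_) (B.integral_abs_compensated_le (le_of_lt hb) hA hfin)
    refine integral_congr_ae ?_
    filter_upwards [B.compensated_ae_eq_sub (le_of_lt hb) hA hfin] with ω hω
    rw [hω]

end Noise

end

section

variable {Ω : Type*} [mΩ : MeasurableSpace Ω] {P : Measure Ω} [IsProbabilityMeasure P]

/-! ### The stochastic integrals are martingales -/

/-- On a probability space `L²` convergence implies `L¹` convergence. The limit is frozen at `T`
because nothing is known about it later. -/
theorem CenteredIncrements.of_tendsto_eLpNorm_two {𝓕 : Filtration ℝ≥0 mΩ} {T : ℝ≥0}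
    {H : ℕ → ℝ≥0 → Ω → ℝ} {M : ℝ≥0 → Ω → ℝ}
    (hH : ∀ k, CenteredIncrements 𝓕 P (H k)) (hHm : ∀ k t, Measurable (H k t))
    (hm : ∀ t ≤ T, Measurable[𝓕 t] (M t))
    (h : ∀ t ≤ T, Tendsto (fun k => eLpNorm (fun ω => H k t ω - M t ω) 2 P) atTop (𝓝 0)) :
    CenteredIncrements 𝓕 P (fun t => M (min t T)) := by
  have hM : ∀ t, Measurable (M (min t T)) := fun t =>
    (hm _ (min_le_right _ _)).mono (𝓕.le _) le_rfl
  refine .of_tendsto (H := fun k t => H k (min t T)) (fun k => (hH k).comp_min T)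
    (fun k t => (hHm k _).aestronglyMeasurable) (fun t => (hM t).aestronglyMeasurable) fun t => ?_
  refine tendsto_of_tendsto_of_tendsto_of_le_of_le tendsto_const_nhds (h _ (min_le_right t T))
    (fun _ => zero_le) fun k => ?_
  exact eLpNorm_le_eLpNorm_of_exponent_le one_le_two
    ((hHm k _).sub (hM t)).aestronglyMeasurable

variable {m d : ℕ} {ν : Measure (Punctured d)} (B : Noise P m ν)

theorem SimpleBrownian.integral_eq_sum {𝓕 : Filtration ℝ≥0 mΩ} (H : SimpleBrownian 𝓕 m)
    (W : ℝ≥0 → Ω → Euc m) (r : ℝ≥0) (ω : Ω) :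
    H.integral W r ω =
      ∑ i, ∑ j, H.ξ i ω j * (W (min (H.t i) r) ω j - W (min (H.s i) r) ω j) := by
  unfold SimpleBrownian.integral
  refine Finset.sum_congr rfl fun i _ => ?_
  rw [PiLp.inner_apply]
  refine Finset.sum_congr rfl fun j _ => ?_
  simp [mul_comm]

theorem SimpleBrownian.centeredIncrements (H : SimpleBrownian B.filtration m) :
    CenteredIncrements B.filtration P (H.integral B.W) := by
  refine CenteredIncrements.congr (M := fun r ω =>
    ∑ i, ∑ j, H.ξ i ω j * (B.W (min (H.t i) r) ω j - B.W (min (H.s i) r) ω j)) ?_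
    fun r => .of_forall fun ω => (H.integral_eq_sum B.W r ω).symm
  refine .sum _ fun i _ => .sum _ fun j _ => ?_
  obtain ⟨C, hC⟩ := H.bounded i
  refine (B.centeredIncrements_brownian j).transform (H.le i) (C := C)
    ((by fun_prop : Measurable fun x : Euc m => x j).comp (H.measurable i)) fun ω => ?_
  exact (PiLp.norm_apply_le (H.ξ i ω) j).trans (hC ω)

theorem SimpleBrownian.measurable_integral (H : SimpleBrownian B.filtration m) (r : ℝ≥0) :
    Measurable (H.integral B.W r) := by
  unfold SimpleBrownian.integral
  refine Finset.measurable_sum _ fun i _ => Measurable.inner ?_ ?_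
  · exact (H.measurable i).mono (B.filtration.le _) le_rfl
  · exact (B.measurable_W _).sub (B.measurable_W _)

theorem IsBrownianIntegral.centeredIncrements {T : ℝ≥0} {Z : ℝ≥0 → Ω → Euc m}
    {I : ℝ≥0 → Ω → ℝ} (h : IsBrownianIntegral B T Z I) :
    CenteredIncrements B.filtration P (fun t => I (min t T)) := by
  obtain ⟨H, -, hH⟩ := h.approx
  exact .of_tendsto_eLpNorm_two (fun k => (H k).centeredIncrements B)
    (fun k t => (H k).measurable_integral B t) h.adapted hH

variable [SigmaFinite ν]

theorem SimplePoisson.centeredIncrements (H : SimplePoisson B.filtration ν) :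
    CenteredIncrements B.filtration P (H.integral B) := by
  refine CenteredIncrements.congr (M := fun r ω => ∑ i, H.ξ i ω *
    (B.compensated 0 (min (H.t i) r) (H.A i) ω - B.compensated 0 (min (H.s i) r) (H.A i) ω)) ?_
    fun r => ?_
  · refine .sum _ fun i _ => ?_
    obtain ⟨C, hC⟩ := H.bounded i
    exact (B.centeredIncrements_compensated (H.measurableSet i) (H.finite i)).transform (H.le i)
      (H.measurable i) hC
  · have h : ∀ᵐ ω ∂P, ∀ i, B.compensated (min (H.s i) r) (min (H.t i) r) (H.A i) ω =
        B.compensated 0 (min (H.t i) r) (H.A i) ω - B.compensated 0 (min (H.s i) r) (H.A i) ω :=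
      ae_all_iff.2 fun i => B.compensated_ae_eq_sub (min_le_min_right r (H.le i))
        (H.measurableSet i) (H.finite i)
    filter_upwards [h] with ω hω
    simp only [SimplePoisson.integral, hω]

theorem SimplePoisson.measurable_integral (H : SimplePoisson B.filtration ν) (r : ℝ≥0) :
    Measurable (H.integral B r) := by
  unfold SimplePoisson.integral
  refine Finset.measurable_sum _ fun i _ => Measurable.mul ?_ ?_
  · exact (H.measurable i).mono (B.filtration.le _) le_rfl
  · exact (ENNReal.measurable_toReal.comp
      (B.measurable_N (measurableSet_Ioc.prod (H.measurableSet i)))).sub_const _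

theorem IsPoissonIntegral.centeredIncrements {T : ℝ≥0} {U : ℝ≥0 → Ω → Lambda2 ν}
    {J : ℝ≥0 → Ω → ℝ} (h : IsPoissonIntegral B T U J) :
    CenteredIncrements B.filtration P (fun t => J (min t T)) := by
  obtain ⟨H, -, hH⟩ := h.approx
  exact .of_tendsto_eLpNorm_two (fun k => (H k).centeredIncrements B)
    (fun k t => (H k).measurable_integral B t) h.adapted hH

/-- The martingale part of the solution of a BSDE. -/
theorem exists_martingale_of_isBSDESolution {T : ℝ≥0}
    {g : ℝ≥0 → Ω → ℝ → Euc m → Lambda2 ν → ℝ} {X : Ω → ℝ} {Y : ℝ≥0 → Ω → ℝ}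
    {Z : ℝ≥0 → Ω → Euc m} {U : ℝ≥0 → Ω → Lambda2 ν} (h : IsBSDESolution B T g X Y Z U) :
    ∃ M : ℝ≥0 → Ω → ℝ, Martingale M B.filtration P ∧
      (∀ ω, ∀ t < T, ContinuousWithinAt (fun t => M t ω) (Set.Ioi t) t) ∧
      ∀ t ≤ T, ∀ᵐ ω ∂P, Y t ω = X ω + (∫ s in Set.Ioc t T, driverAlong g Y Z U s ω ∂leb)
        - (M T ω - M t ω) := by
  obtain ⟨I, J, hI, hJ, heq⟩ := h.equation
  have hIJ := hI.centeredIncrements.add hJ.centeredIncrements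
  have hadapted : ∀ t, Measurable[B.filtration t] fun ω => I (min t T) ω + J (min t T) ω :=
    fun t => ((hI.adapted _ (min_le_right _ _)).add (hJ.adapted _ (min_le_right _ _))).mono
      (B.filtration.mono (min_le_left _ _)) le_rfl
  -- Subtracting the value at time `0` makes every value of the process an increment, hence
  -- integrable, and leaves the equation unchanged.
  have hM : CenteredIncrements B.filtration P (fun t ω => (I (min t T) ω + J (min t T) ω) -
      (I (min 0 T) ω + J (min 0 T) ω)) := by
    constructor
    · intro a b hab
      simpa only [sub_sub_sub_cancel_right] using hIJ.integrable a b hab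
    · intro a b hab A hA
      simpa only [sub_sub_sub_cancel_right] using hIJ.setIntegral a b hab A hA
  refine ⟨_, hM.martingale (fun t => (hadapted t).sub
    ((hadapted 0).mono (B.filtration.mono zero_le) le_rfl))
    (fun t => hIJ.integrable 0 t zero_le), fun ω t ht => ?_, fun t ht => ?_⟩
  · have hmin : ∀ᶠ s in 𝓝[>] t, s = min s T := by
      filter_upwards [Ioo_mem_nhdsGT ht] with s hs using (min_eq_left hs.2.le).symm
    have h1 : ContinuousWithinAt (fun t => I t ω) (Set.Ioi t) t := by
      refine ((hI.continuous ω) t ⟨zero_le, ht.le⟩).mono_of_mem_nhdsWithin ?_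
      filter_upwards [Ioo_mem_nhdsGT ht] with s hs using ⟨zero_le, hs.2.le⟩
    have h2 := (h1.add ((hJ.cadlag ω).1 t ht)).sub
      (continuousWithinAt_const (b := I (min 0 T) ω + J (min 0 T) ω))
    refine h2.congr_of_eventuallyEq ?_ ?_
    · filter_upwards [hmin] with s hs
      rw [← hs]
      rfl
    · simp only [min_eq_left ht.le]
      rfl
  · filter_upwards [heq t ht] with ω hω
    rw [hω, min_self, min_eq_left ht]
    ring

end

/-! ### From the BSDE to resilience rates, given convergence of averages. -/

section

variable {Ω : Type*} [mΩ : MeasurableSpace Ω] {P : Measure Ω} [IsProbabilityMeasure P]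

/-! ### Pathwise form of the equation -/

theorem tendsto_setIntegral_Ioc_timeGrid {T t : ℝ≥0} (ht : t ≤ T) {f : ℝ≥0 → ℝ}
    (hf : IntegrableOn f (Set.Icc 0 T) leb) :
    Tendsto (fun n => ∫ s in Set.Ioc (timeGrid T n t) T, f s ∂leb) atTop
      (𝓝 (∫ s in Set.Ioc t T, f s ∂leb)) := by
  have hind : ∀ a, ∫ s in Set.Ioc a T, f s ∂leb =
      ∫ s in Set.Icc 0 T, (Set.Ioc a T).indicator f s ∂leb := fun a => by
    have h : Set.Ioc a T ⊆ Set.Icc 0 T := fun x hx => ⟨zero_le, hx.2⟩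
    rw [setIntegral_indicator measurableSet_Ioc, Set.inter_eq_self_of_subset_right h]
  simp only [hind]
  refine tendsto_integral_of_dominated_convergence (fun s => ‖f s‖)
    (fun n => hf.1.indicator measurableSet_Ioc) hf.norm
    (fun n => .of_forall fun s => norm_indicator_le_norm_self _ _) (.of_forall fun s => ?_)
  rcases le_or_gt s t with hst | hst
  · refine tendsto_const_nhds.congr fun n => ?_
    rw [Set.indicator_of_notMem fun h => hst.not_gt h.1,
      Set.indicator_of_notMem fun h => (hst.trans (le_timeGrid ht n)).not_gt h.1]
  · refine tendsto_const_nhds.congr' ?_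
    filter_upwards [(tendsto_timeGrid ht).eventually (gt_mem_nhds hst)] with n hn
    simp only [Set.indicator, Set.mem_Ioc, hst, hn]

/-- The grid times are countable, so one null set serves them all, and right-continuity of both
sides extends the identity to every time. This is what permits substituting random times. -/
theorem ae_forall_eq_of_forall_ae_eq {T : ℝ≥0} {X : Ω → ℝ} {Y M ψ : ℝ≥0 → Ω → ℝ}
    (hY : ∀ ω, ∀ t < T, ContinuousWithinAt (fun t => Y t ω) (Set.Ioi t) t)
    (hM : ∀ ω, ∀ t < T, ContinuousWithinAt (fun t => M t ω) (Set.Ioi t) t)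
    (hψ : ∀ᵐ ω ∂P, IntegrableOn (fun s => ψ s ω) (Set.Icc 0 T) leb)
    (h : ∀ t ≤ T, ∀ᵐ ω ∂P, Y t ω = X ω + (∫ s in Set.Ioc t T, ψ s ω ∂leb) - (M T ω - M t ω)) :
    ∀ᵐ ω ∂P, ∀ t ≤ T, Y t ω = X ω + (∫ s in Set.Ioc t T, ψ s ω ∂leb) - (M T ω - M t ω) := by
  have hgrid : ∀ᵐ ω ∂P, ∀ n k : ℕ, Y (min (((k : ℝ≥0) + 1) / (n + 1)) T) ω =
      X ω + (∫ s in Set.Ioc (min (((k : ℝ≥0) + 1) / (n + 1)) T) T, ψ s ω ∂leb) -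
        (M T ω - M (min (((k : ℝ≥0) + 1) / (n + 1)) T) ω) :=
    ae_all_iff.2 fun n => ae_all_iff.2 fun k => h _ (min_le_right _ _)
  filter_upwards [hψ, hgrid] with ω hω hg t ht
  refine tendsto_nhds_unique (tendsto_comp_timeGrid ht (hY ω)) ?_
  refine Tendsto.congr (fun n => (hg n ⌊t * (n + 1)⌋₊).symm) ?_
  exact (tendsto_const_nhds.add (tendsto_setIntegral_Ioc_timeGrid ht hω)).sub
    (tendsto_const_nhds.sub (tendsto_comp_timeGrid ht (hM ω)))

/-- Increments of a solution, simultaneously for all pairs of times. -/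
theorem ae_forall_sub_eq {T : ℝ≥0} {X : Ω → ℝ} {Y M ψ : ℝ≥0 → Ω → ℝ}
    (hψ : ∀ᵐ ω ∂P, IntegrableOn (fun s => ψ s ω) (Set.Icc 0 T) leb)
    (h : ∀ᵐ ω ∂P, ∀ t ≤ T,
      Y t ω = X ω + (∫ s in Set.Ioc t T, ψ s ω ∂leb) - (M T ω - M t ω)) :
    ∀ᵐ ω ∂P, ∀ a b, a ≤ b → b ≤ T →
      Y b ω - Y a ω = -(∫ s in Set.Ioc a b, ψ s ω ∂leb) + (M b ω - M a ω) := by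
  filter_upwards [hψ, h] with ω hω h a b hab hb
  rw [h a (hab.trans hb), h b hb, ← Set.Ioc_union_Ioc_eq_Ioc hab hb,
    setIntegral_union (Set.Ioc_disjoint_Ioc_of_le le_rfl) measurableSet_Ioc
      (hω.mono_set fun x hx => ⟨zero_le, hx.2.trans hb⟩)
      (hω.mono_set fun x hx => ⟨zero_le, hx.2⟩)]
  ring

/-! ### Joint measurability of the driver along the solution -/

theorem predictable_le_prod (𝓕 : Filtration ℝ≥0 mΩ) : 𝓕.predictable ≤ Prod.instMeasurableSpace :=
  measurableSpace_le_predictable_of_measurableSet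
    (fun A hA => (measurableSet_singleton _).prod (𝓕.le _ A hA))
    (fun i A hA => measurableSet_Ioi.prod (𝓕.le i A hA))

theorem predictableOn_le_subtype (𝓕 : Filtration ℝ≥0 mΩ) (T : ℝ≥0) :
    predictableOn 𝓕 T ≤ Subtype.instMeasurableSpace :=
  MeasurableSpace.comap_mono (predictable_le_prod 𝓕)

variable {m d : ℕ} {ν : Measure (Punctured d)} {B : Noise P m ν}

/-- The process `ψ`, set to zero after time `T`. -/
def cutoff (T : ℝ≥0) (ψ : ℝ≥0 → Ω → ℝ) (t : ℝ≥0) (ω : Ω) : ℝ :=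
  (Set.Iic T).indicator (fun t => ψ t ω) t

theorem cutoff_of_le {T t : ℝ≥0} (h : t ≤ T) (ψ : ℝ≥0 → Ω → ℝ) (ω : Ω) :
    cutoff T ψ t ω = ψ t ω :=
  Set.indicator_of_mem (Set.mem_Iic.2 h) _

theorem cutoff_of_gt {T t : ℝ≥0} (h : T < t) (ψ : ℝ≥0 → Ω → ℝ) (ω : Ω) :
    cutoff T ψ t ω = 0 :=
  Set.indicator_of_notMem (fun h' : t ∈ Set.Iic T => h.not_ge (Set.mem_Iic.1 h')) _

/-- Joint measurability is enough for Fubini. Predictability is not sought, as `Y` is only adapted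
and càdlàg; the cutoff is needed because no process is controlled after `T`. -/
theorem measurable_cutoff_driverAlong {T : ℝ≥0} {g : ℝ≥0 → Ω → ℝ → Euc m → Lambda2 ν → ℝ}
    {Y : ℝ≥0 → Ω → ℝ} {Z : ℝ≥0 → Ω → Euc m} {U : ℝ≥0 → Ω → Lambda2 ν}
    (hg : IsDriver B.filtration T g) (hY : MemS2 B.filtration P T Y)
    (hZ : MemH2 B.filtration P T Z) (hU : MemH2 B.filtration P T U) :
    Measurable (Function.uncurry (cutoff T (driverAlong g Y Z U))) := by
  have hs : MeasurableSet {p : ℝ≥0 × Ω | p.1 ≤ T} := measurableSet_le measurable_fst measurable_const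
  have hle := predictableOn_le_subtype B.filtration T
  have hY' : Measurable (fun p : {p : ℝ≥0 × Ω // p.1 ≤ T} => Y p.1.1 p.1.2) := by
    have h := (measurable_uncurry_min_of_rightContinuous (T := T) (Y := Y)
      (fun t ht => (hY.adapted t ht).mono (B.filtration.le t) le_rfl)
      (fun ω => (hY.cadlag ω).1)).comp (measurable_subtype_coe (p := fun p : ℝ≥0 × Ω => p.1 ≤ T))
    convert h using 2 with p
    simp [min_eq_left p.2]
  have hZ' := hZ.predictable.mono hle le_rfl
  have hU' := hU.predictable.mono hle le_rfl
  have hid : @Measurable _ _ Subtype.instMeasurableSpace (predictableOn B.filtration T)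
      (id : {p : ℝ≥0 × Ω // p.1 ≤ T} → _) := measurable_id.mono le_rfl hle
  have hmain : Measurable (fun p : {p : ℝ≥0 × Ω // p.1 ≤ T} =>
      driverAlong g Y Z U p.1.1 p.1.2) :=
    hg.comp (@Measurable.prodMk _ _ _ _ (predictableOn B.filtration T) _ _ _ hid
      (hY'.prodMk (hZ'.prodMk hU')))
  refine measurable_of_restrict_of_restrict_compl hs ?_ ?_
  · have h : Set.domRestrict {p : ℝ≥0 × Ω | p.1 ≤ T}
        (Function.uncurry (cutoff T (driverAlong g Y Z U))) =
        fun p => driverAlong g Y Z U p.1.1 p.1.2 :=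
      funext fun p => cutoff_of_le p.2 _ _
    rw [h]
    exact hmain
  · have h : Set.domRestrict {p : ℝ≥0 × Ω | p.1 ≤ T}ᶜ
        (Function.uncurry (cutoff T (driverAlong g Y Z U))) = fun _ => 0 :=
      funext fun p => cutoff_of_gt (not_le.1 p.2) _ _
    rw [h]
    exact measurable_const

/-! ### Class (D) -/

/-- The uncountable supremum need not be measurable: `lintegral` is monotone for arbitrary
functions. -/
theorem lintegral_sq_stopped_le {T : ℝ≥0} {Y : ℝ≥0 → Ω → ℝ}
    {τ : Ω → ℝ≥0} (hle : ∀ ω, τ ω ≤ T) :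
    ∫⁻ ω, ‖Y (τ ω) ω‖ₑ ^ 2 ∂P ≤ ∫⁻ ω, ⨆ t ∈ Set.Icc 0 T, ‖Y t ω‖ₑ ^ 2 ∂P :=
  lintegral_mono fun ω =>
    le_iSup₂_of_le (f := fun t (_ : t ∈ Set.Icc 0 T) => ‖Y t ω‖ₑ ^ 2) (τ ω) ⟨zero_le, hle ω⟩ le_rfl

theorem MemS2.measurable_stopped {𝓕 : Filtration ℝ≥0 mΩ} {T : ℝ≥0} {Y : ℝ≥0 → Ω → ℝ}
    (hY : MemS2 𝓕 P T Y) {τ : Ω → ℝ≥0}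
    (hτ : IsStoppingTime 𝓕 (fun ω => (τ ω : WithTop ℝ≥0))) (hle : ∀ ω, τ ω ≤ T) :
    Measurable (fun ω => Y (τ ω) ω) :=
  measurable_comp_time (fun t ht => (hY.adapted t ht).mono (𝓕.le t) le_rfl)
    (fun ω => (hY.cadlag ω).1) (measurable_of_isStoppingTime hτ) hle

theorem MemS2.classD {𝓕 : Filtration ℝ≥0 mΩ} {T : ℝ≥0} {Y : ℝ≥0 → Ω → ℝ}
    (hY : MemS2 𝓕 P T Y) : ClassD 𝓕 P T Y := by
  refine uniformIntegrable_of le_rfl ENNReal.one_ne_top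
    (fun τ => (hY.measurable_stopped τ.2.1 τ.2.2).aestronglyMeasurable) fun ε hε => ?_
  set K := ∫⁻ ω, ⨆ t ∈ Set.Icc 0 T, ‖Y t ω‖ₑ ^ 2 ∂P with hK
  have hKtop : K ≠ ∞ := hY.sup_sq.ne
  -- From `C E[|Y_τ|; |Y_τ| ≥ C] ≤ E[Y_τ²] ≤ K`, any `C` with `K ≤ C ε` works; the `+ 1` keeps `C`
  -- nonzero.
  set C : ℝ≥0 := (K.toNNReal + 1) / ε.toNNReal with hC
  have hε' : 0 < ε.toNNReal := Real.toNNReal_pos.2 hε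
  have hC0 : C ≠ 0 := by positivity
  refine ⟨C, fun τ => ?_⟩
  rw [eLpNorm_one_eq_lintegral_enorm]
  have h1 : (C : ℝ≥0∞) * ∫⁻ ω, ‖({ω | C ≤ ‖Y (τ.1 ω) ω‖₊}.indicator
      (fun ω => Y (τ.1 ω) ω)) ω‖ₑ ∂P ≤ K := by
    rw [← lintegral_const_mul' _ _ ENNReal.coe_ne_top]
    refine (lintegral_mono fun ω => ?_).trans (lintegral_sq_stopped_le τ.2.2)
    by_cases h : C ≤ ‖Y (τ.1 ω) ω‖₊
    · rw [Set.indicator_of_mem (by exact h), sq]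
      gcongr
      exact ENNReal.coe_le_coe.2 h
    · rw [Set.indicator_of_notMem (by exact h)]
      simp
  have h2 : K ≤ C * ENNReal.ofReal ε := by
    rw [ENNReal.ofReal, ← ENNReal.coe_mul, hC, div_mul_cancel₀ _ hε'.ne']
    rw [← ENNReal.coe_toNNReal hKtop]
    exact ENNReal.coe_le_coe.2 (by simp)
  exact (ENNReal.mul_le_mul_iff_right (by simpa using hC0) ENNReal.coe_ne_top).1 (h1.trans h2)

theorem MemS2.integrable_stopped {𝓕 : Filtration ℝ≥0 mΩ} {T : ℝ≥0} {Y : ℝ≥0 → Ω → ℝ}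
    (hY : MemS2 𝓕 P T Y) {τ : Ω → ℝ≥0}
    (hτ : IsStoppingTime 𝓕 (fun ω => (τ ω : WithTop ℝ≥0))) (hle : ∀ ω, τ ω ≤ T) :
    Integrable (fun ω => Y (τ ω) ω) P :=
  memLp_one_iff_integrable.1 (hY.classD.memLp ⟨τ, hτ, hle⟩)

/-! ### From convergence of time averages to resilience rates -/

/-- The average of `ψ` over `(τ, (τ + ε) ∧ T]`, normalized by `ε`. -/
def timeAverage (T : ℝ≥0) (ψ : ℝ≥0 → Ω → ℝ) (τ : Ω → ℝ≥0) (ε : ℝ≥0) (ω : Ω) : ℝ :=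
  (ε : ℝ)⁻¹ * ∫ s in Set.Ioc (τ ω) (min (τ ω + ε) T), ψ s ω ∂leb

section Core

variable {𝓕 : Filtration ℝ≥0 mΩ} {T : ℝ≥0} {Y M ψ : ℝ≥0 → Ω → ℝ}

/-- `Y` is a process of the class `𝒮²` whose finite variation part has density `-ψ`. -/
structure HasDrift (𝓕 : Filtration ℝ≥0 mΩ) (P : Measure Ω) (T : ℝ≥0)
    (Y M ψ : ℝ≥0 → Ω → ℝ) : Prop where
  memS2 : MemS2 𝓕 P T Y
  martingale : Martingale M 𝓕 P
  rightContinuous : ∀ ω, ∀ t < T, ContinuousWithinAt (fun t => M t ω) (Set.Ioi t) t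
  sub_eq : ∀ᵐ ω ∂P, ∀ a b, a ≤ b → b ≤ T →
      Y b ω - Y a ω = -(∫ s in Set.Ioc a b, ψ s ω ∂leb) + (M b ω - M a ω)

/-- Integrability comes from the stopped values of `Y` and `M` through the drift equation, not from
a moment of `ψ`. -/
theorem HasDrift.integrable_timeAverage (h : HasDrift 𝓕 P T Y M ψ) {τ : Ω → ℝ≥0}
    (hτ : IsStoppingTime 𝓕 (fun ω => (τ ω : WithTop ℝ≥0))) (hle : ∀ ω, τ ω ≤ T) (ε : ℝ≥0) :
    Integrable (timeAverage T ψ τ ε) P := by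
  have hπ := isStoppingTime_add_min hτ T ε
  have hMτ := (integrable_and_setIntegral_stopped h.martingale h.rightContinuous hτ hle).1
  have hMπ := (integrable_and_setIntegral_stopped h.martingale h.rightContinuous hπ
    fun ω => min_le_right _ _).1
  have hYτ := h.memS2.integrable_stopped hτ hle
  have hYπ := h.memS2.integrable_stopped hπ fun ω => min_le_right _ _
  refine (((hMπ.sub hMτ).sub (hYπ.sub hYτ)).const_mul (ε : ℝ)⁻¹).congr ?_
  filter_upwards [h.sub_eq] with ω hω
  have := hω (τ ω) (min (τ ω + ε) T) (le_min le_self_add (hle ω)) (min_le_right _ _)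
  simp only [Pi.sub_apply, timeAverage]
  rw [this]
  ring

/-- By optional stopping, `M` at `τ` and at `(τ + ε) ∧ T` both have the conditional expectation of
`M T` given `𝓕_σ`, so the martingale part cancels. -/
theorem HasDrift.condExp_increment (h : HasDrift 𝓕 P T Y M ψ) {τ σ : Ω → ℝ≥0}
    (hτ : IsStoppingTime 𝓕 (fun ω => (τ ω : WithTop ℝ≥0))) (hle : ∀ ω, τ ω ≤ T)
    (hσ : IsStoppingTime 𝓕 (fun ω => (σ ω : WithTop ℝ≥0))) (hστ : ∀ᵐ ω ∂P, σ ω ≤ τ ω)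
    {ε : ℝ≥0} (hε : 0 < ε) :
    P[increment T Y τ ε | hσ.measurableSpace] =ᵐ[P]
      fun ω => -((ε : ℝ) * (P[timeAverage T ψ τ ε | hσ.measurableSpace]) ω) := by
  have hπ := isStoppingTime_add_min hτ T ε
  have hσπ : ∀ᵐ ω ∂P, σ ω ≤ min (τ ω + ε) T := by
    filter_upwards [hστ] with ω hω using le_min (hω.trans le_self_add) (hω.trans (hle ω))
  have hMτ := (integrable_and_setIntegral_stopped h.martingale h.rightContinuous hτ hle).1
  have hMπ := (integrable_and_setIntegral_stopped h.martingale h.rightContinuous hπ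
    fun ω => min_le_right _ _).1
  have e1 := condExp_stopped h.martingale h.rightContinuous hτ hle hσ hστ
  have e2 := condExp_stopped h.martingale h.rightContinuous hπ (fun ω => min_le_right _ _) hσ hσπ
  have hA := h.integrable_timeAverage hτ hle ε
  have hε' : (ε : ℝ) ≠ 0 := NNReal.coe_ne_zero.2 hε.ne'
  have e0 : increment T Y τ ε =ᵐ[P] ((fun ω => M (min (τ ω + ε) T) ω) - fun ω => M (τ ω) ω) -
      (ε : ℝ) • timeAverage T ψ τ ε := by
    filter_upwards [h.sub_eq] with ω hω
    have := hω (τ ω) (min (τ ω + ε) T) (le_min le_self_add (hle ω)) (min_le_right _ _)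
    simp only [Pi.sub_apply, Pi.smul_apply, smul_eq_mul, timeAverage, increment]
    rw [this, mul_inv_cancel_left₀ hε']
    ring
  filter_upwards [condExp_congr_ae (m := hσ.measurableSpace) e0,
    condExp_sub (hMπ.sub hMτ) (hA.smul (ε : ℝ)) hσ.measurableSpace,
    condExp_sub hMπ hMτ hσ.measurableSpace,
    condExp_smul (μ := P) (ε : ℝ) (timeAverage T ψ τ ε) hσ.measurableSpace, e1, e2]
    with ω h0 h1 h2 h3 h4 h5
  rw [h0, h1, Pi.sub_apply, h2, Pi.sub_apply, h3, h4, h5]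
  simp

theorem HasDrift.integral_increment (h : HasDrift 𝓕 P T Y M ψ) {τ : Ω → ℝ≥0}
    (hτ : IsStoppingTime 𝓕 (fun ω => (τ ω : WithTop ℝ≥0))) (hle : ∀ ω, τ ω ≤ T)
    {ε : ℝ≥0} (hε : 0 < ε) :
    ∫ ω, increment T Y τ ε ω ∂P = -((ε : ℝ) * ∫ ω, timeAverage T ψ τ ε ω ∂P) := by
  have h1 := h.condExp_increment hτ hle hτ (.of_forall fun _ => le_rfl) hε
  rw [← integral_condExp hτ.measurableSpace_le, integral_congr_ae h1, integral_neg,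
    integral_const_mul, integral_condExp hτ.measurableSpace_le]

theorem HasDrift.hasConditionalResilienceRate (h : HasDrift 𝓕 P T Y M ψ) {τ σ : Ω → ℝ≥0}
    (hτ : IsAdmissibleTime 𝓕 P T τ)
    (hσ : IsStoppingTime 𝓕 (fun ω => (σ ω : WithTop ℝ≥0))) (hστ : ∀ᵐ ω ∂P, σ ω ≤ τ ω)
    {p : ℝ≥0∞} (hp : 1 ≤ p) {R : Ω → ℝ} (hR : MemLp R p P)
    (hlim : Tendsto (fun ε => eLpNorm (fun ω => timeAverage T ψ τ ε ω - R ω) p P)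
      (𝓝[>] 0) (𝓝 0)) :
    HasConditionalResilienceRate 𝓕 P T Y τ σ hσ p
      (fun ω => -(P[R | hσ.measurableSpace]) ω / P.real {ω | τ ω < T}) := by
  have hRint : Integrable R P := hR.integrable hp
  refine ⟨h.memS2.classD, ?_, ?_⟩
  · have := ((hR.condExp (m := hσ.measurableSpace) hp).neg).mul_const (P.real {ω | τ ω < T})⁻¹
    simp only [div_eq_mul_inv]
    exact this
  · set c : ℝ := (P.real {ω | τ ω < T})⁻¹ with hc
    have hlim' := ENNReal.Tendsto.const_mul (a := ‖c‖ₑ) hlim (.inr enorm_ne_top)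
    rw [mul_zero] at hlim'
    refine tendsto_of_tendsto_of_tendsto_of_le_of_le' tendsto_const_nhds hlim'
      (.of_forall fun _ => zero_le) ?_
    filter_upwards [self_mem_nhdsWithin] with ε hε
    have hε0 : (ε : ℝ) ≠ 0 := NNReal.coe_ne_zero.2 (ne_of_gt hε)
    have hA := h.integrable_timeAverage hτ.isStoppingTime hτ.le_horizon ε
    have heq : (fun ω => (P[increment T Y τ ε | hσ.measurableSpace]) ω /
        ((ε : ℝ) * P.real {ω | τ ω < T}) -
          -(P[R | hσ.measurableSpace]) ω / P.real {ω | τ ω < T}) =ᵐ[P]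
        -c • P[timeAverage T ψ τ ε - R | hσ.measurableSpace] := by
      filter_upwards [h.condExp_increment hτ.isStoppingTime hτ.le_horizon hσ hστ hε,
        condExp_sub hA hRint hσ.measurableSpace] with ω h1 h2
      rw [h1, Pi.smul_apply, h2, Pi.sub_apply, smul_eq_mul, hc, div_eq_mul_inv, mul_inv,
        div_eq_mul_inv]
      have : (ε : ℝ) * (ε : ℝ)⁻¹ = 1 := mul_inv_cancel₀ hε0
      linear_combination (-(P[timeAverage T ψ τ ε | hσ.measurableSpace]) ω *
        (P.real {ω | τ ω < T})⁻¹) * this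
    rw [eLpNorm_congr_ae heq, eLpNorm_const_smul, enorm_neg]
    gcongr
    exact eLpNorm_condExp_le_eLpNorm _ hp

theorem HasDrift.hasResilienceRate (h : HasDrift 𝓕 P T Y M ψ) {τ : Ω → ℝ≥0}
    (hτ : IsAdmissibleTime 𝓕 P T τ)
    {p : ℝ≥0∞} (hp : 1 ≤ p) {R : Ω → ℝ} (hR : MemLp R p P)
    (hlim : Tendsto (fun ε => eLpNorm (fun ω => timeAverage T ψ τ ε ω - R ω) p P)
      (𝓝[>] 0) (𝓝 0)) :
    HasResilienceRate 𝓕 P T Y τ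
      ((-((P.real {ω | τ ω < T})⁻¹ * ∫ ω, R ω ∂P) : ℝ) : EReal) := by
  refine ⟨h.memS2.classD, (continuous_coe_real_ereal.tendsto _).comp ?_⟩
  have hm : MeasurableSet {ω | τ ω < T} :=
    measurableSet_lt (measurable_of_isStoppingTime hτ.isStoppingTime) measurable_const
  have hint := h.integrable_timeAverage hτ.isStoppingTime hτ.le_horizon
  have hRint : Integrable R P := hR.integrable hp
  have h1 : Tendsto (fun ε => eLpNorm (timeAverage T ψ τ ε - R) 1 P) (𝓝[>] 0) (𝓝 0) :=
    tendsto_of_tendsto_of_tendsto_of_le_of_le tendsto_const_nhds hlim (fun _ => zero_le) fun ε =>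
      eLpNorm_le_eLpNorm_of_exponent_le hp ((hint ε).sub hRint).1
  have h2 := tendsto_integral_of_L1' R hRint.1 (.of_forall hint) h1
  refine (h2.const_mul (P.real {ω | τ ω < T})⁻¹).neg.congr' ?_
  filter_upwards [self_mem_nhdsWithin] with ε hε
  have hε0 : (ε : ℝ) ≠ 0 := NNReal.coe_ne_zero.2 (ne_of_gt hε)
  -- On `{τ = T}` the increment vanishes, so conditioning on `τ < T` amounts to dividing by its
  -- probability.
  have h3 : ∫ ω in {ω | τ ω < T}, increment T Y τ ε ω ∂P = ∫ ω, increment T Y τ ε ω ∂P := by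
    refine setIntegral_eq_integral_of_forall_compl_eq_zero fun ω hω => ?_
    have : τ ω = T := le_antisymm (hτ.le_horizon ω) (not_lt.1 hω)
    simp [increment, this]
  rw [ProbabilityTheory.cond, integral_smul_measure, h3,
    h.integral_increment hτ.isStoppingTime hτ.le_horizon hε, ENNReal.toReal_inv, smul_eq_mul,
    measureReal_def]
  field_simp

end Core

end

/-! ### Lebesgue differentiation of random paths and the passage to `Lᵠ`. -/

section

/-! ### Lebesgue differentiation on the half-line -/

theorem ae_leb_of_ae_volume {p : ℝ → Prop} (h : ∀ᵐ x, p x) : ∀ᵐ t : ℝ≥0 ∂leb, p t := by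
  rw [ae_iff, leb_apply]
  refine measure_mono_null ?_ h
  rintro _ ⟨t, ht, rfl⟩
  exact ht

/-- The extension by zero of a function on the half-line. -/
def extendZero (f : ℝ≥0 → ℝ) (x : ℝ) : ℝ := (Set.Ici 0).indicator (fun x => f x.toNNReal) x

theorem extendZero_coe (f : ℝ≥0 → ℝ) (t : ℝ≥0) : extendZero f t = f t := by
  simp [extendZero]

theorem map_coe_leb : leb.map (fun t : ℝ≥0 => (t : ℝ)) = volume.restrict (Set.Ici 0) := by
  rw [leb, measurableEmbedding_coe_nnreal.map_comap]
  congr 1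
  exact Subtype.range_coe

theorem integrable_extendZero {f : ℝ≥0 → ℝ} (hf : Integrable f leb) :
    Integrable (extendZero f) volume := by
  have h : Integrable (extendZero f) (leb.map (fun t : ℝ≥0 => (t : ℝ))) := by
    rw [measurableEmbedding_coe_nnreal.integrable_map_iff]
    simpa only [Function.comp_def, extendZero_coe] using hf
  rw [map_coe_leb] at h
  have h' : extendZero f = (Set.Ici 0).indicator (extendZero f) := by
    unfold extendZero
    rw [Set.indicator_indicator, Set.inter_self]
  rw [h']
  exact (integrable_indicator_iff measurableSet_Ici).2 h

theorem setIntegral_Ioc_leb (f : ℝ≥0 → ℝ) {a b : ℝ≥0} (hab : a ≤ b) :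
    ∫ s in Set.Ioc a b, f s ∂leb = ∫ x in (a : ℝ)..b, extendZero f x := by
  rw [intervalIntegral.integral_of_le (NNReal.coe_le_coe.2 hab),
    ← Set.inter_eq_self_of_subset_left
      (show Set.Ioc (a : ℝ) b ⊆ Set.Ici 0 from fun x hx => a.2.trans hx.1.le),
    ← Measure.restrict_restrict measurableSet_Ioc, ← map_coe_leb,
    measurableEmbedding_coe_nnreal.setIntegral_map]
  simp only [extendZero_coe]
  congr 2

theorem setIntegral_Ioc_add {f : ℝ≥0 → ℝ} (hf : Integrable f leb) (t ε : ℝ≥0) :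
    ∫ s in Set.Ioc t (t + ε), f s ∂leb =
      (∫ x in (0 : ℝ)..(t + ε : ℝ), extendZero f x) - ∫ x in (0 : ℝ)..t, extendZero f x := by
  have h := integrable_extendZero hf
  rw [setIntegral_Ioc_leb f le_self_add, NNReal.coe_add,
    intervalIntegral.integral_interval_sub_left h.intervalIntegrable h.intervalIntegrable]

theorem continuous_setIntegral_Ioc_add {f : ℝ≥0 → ℝ} (hf : Integrable f leb) (t : ℝ≥0) :
    Continuous (fun ε : ℝ≥0 => ∫ s in Set.Ioc t (t + ε), f s ∂leb) := by
  have h := integrable_extendZero hf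
  simp only [setIntegral_Ioc_add hf]
  have h' := intervalIntegral.continuous_primitive
    (fun a b => h.intervalIntegrable (a := a) (b := b)) 0
  exact (h'.comp (by fun_prop : Continuous fun ε : ℝ≥0 => (t : ℝ) + ε)).sub continuous_const

theorem tendsto_coe_nhdsGT_zero :
    Tendsto (fun ε : ℝ≥0 => (ε : ℝ)) (𝓝[>] 0) (𝓝[>] 0) := by
  refine tendsto_nhdsWithin_iff.2 ⟨?_, ?_⟩
  · exact (NNReal.continuous_coe.tendsto' 0 0 rfl).mono_left nhdsWithin_le_nhds
  · filter_upwards [self_mem_nhdsWithin] with ε hε using NNReal.coe_pos.2 hε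

/-- The Lebesgue differentiation theorem for averages to the right. -/
theorem ae_tendsto_average_right {f : ℝ≥0 → ℝ} (hf : Integrable f leb) :
    ∀ᵐ t ∂leb, Tendsto (fun ε : ℝ≥0 => (ε : ℝ)⁻¹ * ∫ s in Set.Ioc t (t + ε), f s ∂leb)
      (𝓝[>] 0) (𝓝 (f t)) := by
  have h := integrable_extendZero hf
  filter_upwards [ae_leb_of_ae_volume
    (_root_.LocallyIntegrable.ae_hasDerivAt_integral h.locallyIntegrable)] with t ht
  have h1 := (ht 0).tendsto_slope_zero_right.comp tendsto_coe_nhdsGT_zero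
  rw [extendZero_coe] at h1
  refine h1.congr fun ε => ?_
  simp only [Function.comp_apply, smul_eq_mul]
  rw [setIntegral_Ioc_add hf]

/-- A function which is continuous on `(0, ∞)` has a limit at `0⁺` as soon as it has one along
the rationals. -/
theorem tendsto_nhdsGT_of_tendsto_nnrat {G : ℝ≥0 → ℝ} {l : ℝ} (hG : ContinuousOn G (Set.Ioi 0))
    (h : Tendsto (fun r : ℚ≥0 => G r) (comap (fun r : ℚ≥0 => (r : ℝ≥0)) (𝓝[>] 0)) (𝓝 l)) :
    Tendsto G (𝓝[>] 0) (𝓝 l) := by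
  refine Metric.nhds_basis_closedBall.tendsto_right_iff.2 fun δ hδ => ?_
  obtain ⟨s, hs, hsub⟩ := mem_comap.1 (h (Metric.closedBall_mem_nhds l hδ))
  obtain ⟨u, hu, hu'⟩ := (mem_nhdsGT_iff_exists_Ioo_subset).1 hs
  have hdense : Dense (Set.range (fun r : ℚ≥0 => (r : ℝ≥0))) := by
    refine dense_of_exists_between fun a b hab => ?_
    obtain ⟨q, hq1, hq2⟩ := exists_rat_btwn (NNReal.coe_lt_coe.2 hab)
    have hq : 0 ≤ q := by exact_mod_cast (a.2.trans hq1.le)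
    lift q to ℚ≥0 using hq
    exact ⟨_, ⟨q, rfl⟩, by exact_mod_cast hq1, by exact_mod_cast hq2⟩
  filter_upwards [Ioo_mem_nhdsGT hu] with ε hε
  have h1 : ε ∈ closure (Set.Ioo 0 u ∩ Set.range (fun r : ℚ≥0 => (r : ℝ≥0))) :=
    hdense.open_subset_closure_inter isOpen_Ioo hε
  have h2 : ContinuousWithinAt G (Set.Ioo 0 u ∩ Set.range (fun r : ℚ≥0 => (r : ℝ≥0))) ε :=
    (hG ε hε.1).mono fun x hx => hx.1.1
  have h3 := h2.mem_closure_image h1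
  refine closure_minimal ?_ Metric.isClosed_closedBall h3
  rintro _ ⟨_, ⟨hx, r, rfl⟩, rfl⟩
  exact hsub (show (r : ℝ≥0) ∈ s from hu' hx)

variable {Ω : Type*} [mΩ : MeasurableSpace Ω] {P : Measure Ω} [IsProbabilityMeasure P]

theorem measurable_setIntegral_Ioc {F : ℝ≥0 → Ω → ℝ} (hF : Measurable (Function.uncurry F))
    (r : ℝ≥0) :
    Measurable (fun p : ℝ≥0 × Ω => ∫ s in Set.Ioc p.1 (p.1 + r), F s p.2 ∂leb) := by
  have hs : MeasurableSet {q : (ℝ≥0 × Ω) × ℝ≥0 | q.2 ∈ Set.Ioc q.1.1 (q.1.1 + r)} :=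
    (measurableSet_lt (by fun_prop) (by fun_prop)).inter
      (measurableSet_le (by fun_prop) (by fun_prop))
  have h : Measurable ({q : (ℝ≥0 × Ω) × ℝ≥0 | q.2 ∈ Set.Ioc q.1.1 (q.1.1 + r)}.indicator
      fun q => F q.2 q.1.2) :=
    (hF.comp (by fun_prop : Measurable fun q : (ℝ≥0 × Ω) × ℝ≥0 => (q.2, q.1.2))).indicator hs
  have h' := (h.stronglyMeasurable.integral_prod_right' (ν := leb)).measurable
  have heq : (fun p : ℝ≥0 × Ω => ∫ s in Set.Ioc p.1 (p.1 + r), F s p.2 ∂leb) =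
      fun p => ∫ s, {q : (ℝ≥0 × Ω) × ℝ≥0 | q.2 ∈ Set.Ioc q.1.1 (q.1.1 + r)}.indicator
        (fun q => F q.2 q.1.2) (p, s) ∂leb :=
    funext fun p => (integral_indicator measurableSet_Ioc).symm
  rw [heq]
  exact h'

theorem measurable_setLIntegral_Ioc {F : ℝ≥0 → Ω → ℝ≥0∞} (hF : Measurable (Function.uncurry F))
    (t r : ℝ≥0) : Measurable (fun ω => ∫⁻ s in Set.Ioc t (t + r), F s ω ∂leb) :=
  (hF.comp measurable_swap).lintegral_prod_right'

/-- Lebesgue differentiation of the paths of a process: for almost every time, almost surely. -/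
theorem ae_ae_tendsto_average_right {F : ℝ≥0 → Ω → ℝ} (hF : Measurable (Function.uncurry F))
    (hint : ∀ᵐ ω ∂P, Integrable (fun s => F s ω) leb) :
    ∀ᵐ t ∂leb, ∀ᵐ ω ∂P,
      Tendsto (fun ε : ℝ≥0 => (ε : ℝ)⁻¹ * ∫ s in Set.Ioc t (t + ε), F s ω ∂leb)
        (𝓝[>] 0) (𝓝 (F t ω)) := by
  -- Restricting to rational `ε` makes the convergence set measurable, which the exchange of "almost
  -- every `t`" and "almost every `ω`" requires. Continuity in `ε` restores the full limit.
  set l : Filter ℚ≥0 := comap (fun r : ℚ≥0 => (r : ℝ≥0)) (𝓝[>] 0) with hl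
  let D : ℚ≥0 → Ω × ℝ≥0 → ℝ := fun r p =>
    (((r : ℝ≥0) : ℝ)⁻¹ * ∫ s in Set.Ioc p.2 (p.2 + r), F s p.1 ∂leb) - F p.2 p.1
  have hD : ∀ r, Measurable (D r) := fun r =>
    (((measurable_setIntegral_Ioc hF r).comp measurable_swap).const_mul _).sub
      (hF.comp measurable_swap)
  have hS : MeasurableSet {p | Tendsto (fun r => D r p) l (𝓝 0)} := measurableSet_tendsto _ hD
  have h1 : ∀ᵐ ω ∂P, ∀ᵐ t ∂leb, Tendsto (fun r => D r (ω, t)) l (𝓝 0) := by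
    filter_upwards [hint] with ω hω
    filter_upwards [ae_tendsto_average_right hω] with t ht
    have := (ht.comp (tendsto_comap (f := fun r : ℚ≥0 => (r : ℝ≥0)))).sub_const (F t ω)
    rw [sub_self] at this
    exact this
  have h2 := (Measure.ae_ae_comm hS).1 h1
  filter_upwards [h2] with t ht
  filter_upwards [ht, hint] with ω h3 h4
  refine tendsto_nhdsGT_of_tendsto_nnrat ?_ ?_
  · refine ContinuousOn.mul ?_ (continuous_setIntegral_Ioc_add h4 t).continuousOn
    exact ContinuousOn.inv₀ NNReal.continuous_coe.continuousOn
      fun ε hε => NNReal.coe_ne_zero.2 (ne_of_gt hε)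
  · have := h3.add_const (F t ω)
    simpa [D] using this

theorem inv_mul_setLIntegral_eq_ofReal {f : ℝ≥0 → ℝ≥0∞} (hf : Measurable f)
    (hfin : ∫⁻ s, f s ∂leb ≠ ∞) (t : ℝ≥0) {ε : ℝ≥0} (hε : 0 < ε) :
    (ε : ℝ≥0∞)⁻¹ * ∫⁻ s in Set.Ioc t (t + ε), f s ∂leb =
      ENNReal.ofReal ((ε : ℝ)⁻¹ * ∫ s in Set.Ioc t (t + ε), (f s).toReal ∂leb) := by
  have hfin' : ∫⁻ s in Set.Ioc t (t + ε), f s ∂leb ≠ ∞ :=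
    ((setLIntegral_le_lintegral _ _).trans_lt hfin.lt_top).ne
  rw [integral_toReal hf.aemeasurable (ae_lt_top hf hfin'),
    ENNReal.ofReal_mul (by positivity), ENNReal.ofReal_toReal hfin', ← NNReal.coe_inv,
    ENNReal.ofReal_coe_nnreal, ENNReal.coe_inv hε.ne']

theorem ae_tendsto_laverage_right {f : ℝ≥0 → ℝ≥0∞} (hf : Measurable f)
    (hfin : ∫⁻ s, f s ∂leb ≠ ∞) :
    ∀ᵐ t ∂leb, Tendsto (fun ε : ℝ≥0 => (ε : ℝ≥0∞)⁻¹ * ∫⁻ s in Set.Ioc t (t + ε), f s ∂leb)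
      (𝓝[>] 0) (𝓝 (f t)) := by
  filter_upwards [ae_tendsto_average_right (integrable_toReal_of_lintegral_ne_top
    hf.aemeasurable hfin), ae_lt_top hf hfin] with t ht ht'
  have h := ENNReal.tendsto_ofReal ht
  rw [ENNReal.ofReal_toReal ht'.ne] at h
  refine h.congr' ?_
  filter_upwards [self_mem_nhdsWithin] with ε hε
  exact (inv_mul_setLIntegral_eq_ofReal hf hfin t hε).symm

theorem ae_ae_tendsto_laverage_right {F : ℝ≥0 → Ω → ℝ≥0∞} (hF : Measurable (Function.uncurry F))
    (hfin : ∀ᵐ ω ∂P, ∫⁻ s, F s ω ∂leb ≠ ∞) :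
    ∀ᵐ t ∂leb, ∀ᵐ ω ∂P,
      Tendsto (fun ε : ℝ≥0 => (ε : ℝ≥0∞)⁻¹ * ∫⁻ s in Set.Ioc t (t + ε), F s ω ∂leb)
        (𝓝[>] 0) (𝓝 (F t ω)) := by
  have hFω : ∀ ω, Measurable fun s => F s ω := fun ω => hF.comp measurable_prodMk_right
  have h1 := ae_ae_tendsto_average_right (P := P) (F := fun s ω => (F s ω).toReal)
    hF.ennreal_toReal (by
      filter_upwards [hfin] with ω hω
      exact integrable_toReal_of_lintegral_ne_top (hFω ω).aemeasurable hω)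
  have h2 : ∀ᵐ t ∂leb, ∀ᵐ ω ∂P, F t ω < ∞ := by
    have hS : MeasurableSet {p : Ω × ℝ≥0 | F p.2 p.1 < ∞} :=
      measurableSet_lt (hF.comp measurable_swap) measurable_const
    refine (Measure.ae_ae_comm hS).1 ?_
    filter_upwards [hfin] with ω hω using ae_lt_top (hFω ω) hω
  filter_upwards [h1, h2] with t h1 h2
  filter_upwards [h1, h2, hfin] with ω h1 h2 h3
  have h := ENNReal.tendsto_ofReal h1
  rw [ENNReal.ofReal_toReal h2.ne] at h
  refine h.congr' ?_
  filter_upwards [self_mem_nhdsWithin] with ε hε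
  exact (inv_mul_setLIntegral_eq_ofReal (hFω ω) h3 t hε).symm

/-! ### Convergence of averages in `Lᵠ` -/

/-- Jensen's inequality, in the form of monotonicity of `Lᵖ` norms for normalized Lebesgue measure
on `(t, t + ε]`. -/
theorem enorm_average_rpow_le {f : ℝ≥0 → ℝ} (hf : Measurable f) {q : ℝ} (hq : 1 ≤ q) (t ε : ℝ≥0) :
    ‖(ε : ℝ)⁻¹ * ∫ s in Set.Ioc t (t + ε), f s ∂leb‖ₑ ^ q ≤
      (ε : ℝ≥0∞)⁻¹ * ∫⁻ s in Set.Ioc t (t + ε), ‖f s‖ₑ ^ q ∂leb := by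
  have hq0 : 0 < q := one_pos.trans_le hq
  rcases eq_zero_or_pos ε with rfl | hε
  · simp [hq0]
  set μ : Measure ℝ≥0 := (ε : ℝ≥0∞)⁻¹ • leb.restrict (Set.Ioc t (t + ε)) with hμ
  have : IsProbabilityMeasure μ := by
    refine ⟨?_⟩
    rw [hμ, Measure.smul_apply, Measure.restrict_apply_univ, leb_Ioc, NNReal.coe_add,
      add_sub_cancel_left, ENNReal.ofReal_coe_nnreal, smul_eq_mul,
      ENNReal.inv_mul_cancel (ENNReal.coe_ne_zero.2 hε.ne') ENNReal.coe_ne_top]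
  have h1 : ‖(ε : ℝ)⁻¹ * ∫ s in Set.Ioc t (t + ε), f s ∂leb‖ₑ ≤ eLpNorm f 1 μ := by
    rw [eLpNorm_one_eq_lintegral_enorm, hμ, lintegral_smul_measure, enorm_mul, smul_eq_mul]
    gcongr
    · rw [enorm_inv (NNReal.coe_ne_zero.2 hε.ne'), Real.enorm_eq_ofReal ε.coe_nonneg,
        ENNReal.ofReal_coe_nnreal]
    · exact enorm_integral_le_lintegral_enorm _
  have h2 : eLpNorm f 1 μ ≤ eLpNorm f (ENNReal.ofReal q) μ :=
    eLpNorm_le_eLpNorm_of_exponent_le (by simpa using ENNReal.ofReal_le_ofReal hq)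
      hf.aestronglyMeasurable
  have h3 := ENNReal.rpow_le_rpow (h1.trans h2) hq0.le
  rw [eLpNorm_eq_lintegral_rpow_enorm_toReal (by simpa using hq0) ENNReal.ofReal_ne_top,
    ENNReal.toReal_ofReal hq0.le, ← ENNReal.rpow_mul, one_div, inv_mul_cancel₀ hq0.ne',
    ENNReal.rpow_one, hμ, lintegral_smul_measure, smul_eq_mul] at h3
  exact h3

/-- A dominated convergence theorem in `Lᵠ` with convergent majorants. -/
theorem tendsto_eLpNorm_of_tendsto_majorant {q : ℝ} (hq : 1 ≤ q) {D : ℕ → Ω → ℝ} {R : Ω → ℝ}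
    {A : ℕ → Ω → ℝ≥0∞} {A' : Ω → ℝ≥0∞} (hD : ∀ n, AEStronglyMeasurable (D n) P)
    (hA : ∀ n, AEMeasurable (A n) P) (hA' : AEMeasurable A' P)
    (hDA : ∀ n, ∀ᵐ ω ∂P, ‖D n ω‖ₑ ^ q ≤ A n ω)
    (hlimD : ∀ᵐ ω ∂P, Tendsto (fun n => D n ω) atTop (𝓝 (R ω)))
    (hlimA : ∀ᵐ ω ∂P, Tendsto (fun n => A n ω) atTop (𝓝 (A' ω)))
    (hfin : ∫⁻ ω, A' ω ∂P ≠ ∞)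
    (hint : Tendsto (fun n => ∫⁻ ω, A n ω ∂P) atTop (𝓝 (∫⁻ ω, A' ω ∂P))) :
    MemLp R (ENNReal.ofReal q) P ∧
      Tendsto (fun n => eLpNorm (fun ω => D n ω - R ω) (ENNReal.ofReal q) P) atTop (𝓝 0) := by
  have hq0 : 0 < q := one_pos.trans_le hq
  have hR : AEStronglyMeasurable R P := aestronglyMeasurable_of_tendsto_ae atTop hD hlimD
  have hDA' := ae_all_iff.2 hDA
  have hRA : ∀ᵐ ω ∂P, ‖R ω‖ₑ ^ q ≤ A' ω := by
    filter_upwards [hDA', hlimD, hlimA] with ω h1 h2 h3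
    exact le_of_tendsto_of_tendsto' ((ENNReal.continuous_rpow_const.tendsto _).comp h2.enorm) h3 h1
  have hnorm : ∀ f : Ω → ℝ, eLpNorm f (ENNReal.ofReal q) P = (∫⁻ ω, ‖f ω‖ₑ ^ q ∂P) ^ (1 / q) :=
    fun f => by
      rw [eLpNorm_eq_lintegral_rpow_enorm_toReal (by simpa using hq0) ENNReal.ofReal_ne_top,
        ENNReal.toReal_ofReal hq0.le]
  refine ⟨⟨hR, ?_⟩, ?_⟩
  · rw [hnorm]
    exact ENNReal.rpow_lt_top_of_nonneg (by positivity)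
      ((lintegral_mono_ae hRA).trans_lt hfin.lt_top).ne
  simp only [hnorm]
  have hz : (0 : ℝ≥0∞) ^ (1 / q) = 0 := ENNReal.zero_rpow_of_pos (by positivity)
  rw [← hz]
  refine (ENNReal.continuous_rpow_const.tendsto 0).comp ?_
  -- The constant in `(a + b)^q ≤ 2^(q-1) (a^q + b^q)`. The aim is `|D_n - R|^q ≤ min(|D_n - R|^q,
  -- 2cA') + c (A_n - A')⁺`, with both terms tending to zero in mean.
  set c : ℝ≥0∞ := 2 ^ (q - 1) with hc
  have hc_top : c ≠ ∞ := ENNReal.rpow_ne_top_of_nonneg (by linarith) ENNReal.ofNat_ne_top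
  have hfm : ∀ n, AEMeasurable (fun ω => ‖D n ω - R ω‖ₑ ^ q) P := fun n =>
    ((hD n).sub hR).enorm.pow_const q
  -- The subtraction is truncated, so this is the positive part, equal to `A_n - min(A_n, A')`. The
  -- minimum is dominated by `A'`, and `∫ A_n → ∫ A'` by hypothesis.
  have hexc : Tendsto (fun n => ∫⁻ ω, (A n ω - A' ω) ∂P) atTop (𝓝 0) := by
    have hmin : Tendsto (fun n => ∫⁻ ω, min (A n ω) (A' ω) ∂P) atTop (𝓝 (∫⁻ ω, A' ω ∂P)) := by
      refine tendsto_lintegral_of_dominated_convergence' A' (fun n => (hA n).min hA')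
        (fun n => .of_forall fun ω => min_le_right _ _) hfin ?_
      filter_upwards [hlimA] with ω hω
      have h1 := hω.min (tendsto_const_nhds (x := A' ω))
      rwa [min_self] at h1
    have h0 := ENNReal.Tendsto.sub hint hmin (.inl hfin)
    rw [tsub_self] at h0
    refine h0.congr fun n => ?_
    rw [← lintegral_sub' ((hA n).min hA')
      (ne_top_of_le_ne_top hfin (lintegral_mono fun ω => min_le_right _ _))
      (.of_forall fun ω => min_le_left _ _)]
    refine lintegral_congr fun ω => ?_
    rcases le_total (A n ω) (A' ω) with h | h
    · rw [min_eq_left h, tsub_self, tsub_eq_zero_of_le h]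
    · rw [min_eq_right h]
  have hmain : Tendsto (fun n => ∫⁻ ω, min (‖D n ω - R ω‖ₑ ^ q) (2 * c * A' ω) ∂P)
      atTop (𝓝 0) := by
    have hfin' : ∫⁻ ω, 2 * c * A' ω ∂P ≠ ∞ := by
      rw [lintegral_const_mul'' _ hA']
      exact ENNReal.mul_ne_top (ENNReal.mul_ne_top ENNReal.ofNat_ne_top hc_top) hfin
    rw [← lintegral_zero (μ := P)]
    refine tendsto_lintegral_of_dominated_convergence' (fun ω => 2 * c * A' ω)
      (fun n => (hfm n).min (hA'.const_mul _)) (fun n => .of_forall fun ω => min_le_right _ _)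
      hfin' ?_
    filter_upwards [hlimD] with ω hω
    have h1 : Tendsto (fun n => ‖D n ω - R ω‖ₑ ^ q) atTop (𝓝 0) := by
      have h2 := (hω.sub_const (R ω)).enorm
      rw [sub_self, enorm_zero] at h2
      have h3 := (ENNReal.continuous_rpow_const (y := q)).tendsto 0 |>.comp h2
      rwa [ENNReal.zero_rpow_of_pos hq0] at h3
    exact tendsto_of_tendsto_of_tendsto_of_le_of_le tendsto_const_nhds h1 (fun _ => zero_le)
      fun n => min_le_left _ _
  have hsum := hmain.add (ENNReal.Tendsto.const_mul (a := c) hexc (.inr hc_top))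
  rw [mul_zero, add_zero] at hsum
  refine tendsto_of_tendsto_of_tendsto_of_le_of_le tendsto_const_nhds hsum (fun _ => zero_le)
    fun n => ?_
  rw [← lintegral_const_mul' _ _ hc_top, ← lintegral_add_left' ((hfm n).min (hA'.const_mul _))]
  refine lintegral_mono_ae ?_
  filter_upwards [hDA n, hRA] with ω h1 h2
  have h3 : ‖D n ω - R ω‖ₑ ^ q ≤ c * (A n ω + A' ω) := by
    refine (ENNReal.rpow_le_rpow (enorm_sub_le (a := D n ω) (b := R ω)) hq0.le).trans ?_
    refine (ENNReal.rpow_add_le_mul_rpow_add_rpow _ _ hq).trans ?_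
    gcongr
  rcases le_total (‖D n ω - R ω‖ₑ ^ q) (2 * c * A' ω) with h | h
  · rw [min_eq_left h]
    exact le_self_add
  · rw [min_eq_right h]
    refine h3.trans ?_
    calc c * (A n ω + A' ω) ≤ c * ((A n ω - A' ω + A' ω) + A' ω) := by
          gcongr
          exact le_tsub_add
      _ = 2 * c * A' ω + c * (A n ω - A' ω) := by ring

end

section

variable {Ω : Type*} [mΩ : MeasurableSpace Ω] {P : Measure Ω} [IsProbabilityMeasure P]
variable {T : ℝ≥0} {ψ : ℝ≥0 → Ω → ℝ}

/-! ### Convergence of the time averages of the driver -/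

theorem timeAverage_eq_cutoff (τ : Ω → ℝ≥0) (ε : ℝ≥0) (ω : Ω) :
    timeAverage T ψ τ ε ω =
      (ε : ℝ)⁻¹ * ∫ s in Set.Ioc (τ ω) (τ ω + ε), cutoff T ψ s ω ∂leb := by
  unfold timeAverage cutoff
  rw [setIntegral_indicator measurableSet_Iic, Set.Ioc_inter_Iic]

theorem measurable_timeAverage (hψ : Measurable (Function.uncurry (cutoff T ψ))) {τ : Ω → ℝ≥0}
    (hτ : Measurable τ) (ε : ℝ≥0) : Measurable (timeAverage T ψ τ ε) := by
  have h : timeAverage T ψ τ ε = fun ω =>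
      (ε : ℝ)⁻¹ * ∫ s in Set.Ioc (τ ω) (τ ω + ε), cutoff T ψ s ω ∂leb :=
    funext fun ω => timeAverage_eq_cutoff τ ε ω
  rw [h]
  exact ((measurable_setIntegral_Ioc hψ ε).comp (hτ.prodMk measurable_id)).const_mul _

theorem integrable_cutoff {ω : Ω} (h : IntegrableOn (fun s => ψ s ω) (Set.Icc 0 T) leb) :
    Integrable (fun s => cutoff T ψ s ω) leb := by
  have h0 : Set.Icc 0 T = Set.Iic T := Set.ext fun x => by simp
  rw [h0] at h
  exact (integrable_indicator_iff measurableSet_Iic).2 h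

theorem lintegral_cutoff_rpow {q : ℝ} (hq : 0 < q) (ω : Ω) :
    ∫⁻ s, ‖cutoff T ψ s ω‖ₑ ^ q ∂leb = ∫⁻ s in Set.Icc 0 T, ‖ψ s ω‖ₑ ^ q ∂leb := by
  rw [← lintegral_indicator measurableSet_Icc]
  refine lintegral_congr fun s => ?_
  rcases le_or_gt s T with h | h
  · rw [cutoff_of_le h, Set.indicator_of_mem (show s ∈ Set.Icc 0 T from ⟨zero_le, h⟩)]
  · rw [cutoff_of_gt h, Set.indicator_of_notMem fun h' : s ∈ Set.Icc 0 T => h.not_ge h'.2, enorm_zero,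
      ENNReal.zero_rpow_of_pos hq]

/-- The good times are the right Lebesgue points, for almost every path, of `ψ` and `|ψ|^q`, and
also of `t ↦ E|ψ_t|^q`. By Tonelli the last gives convergence of the expected majorants. -/
theorem ae_tendsto_eLpNorm_timeAverage_const (hψ : Measurable (Function.uncurry (cutoff T ψ)))
    (hint : ∀ᵐ ω ∂P, IntegrableOn (fun s => ψ s ω) (Set.Icc 0 T) leb) {q : ℝ} (hq : 1 ≤ q)
    (hfin : ∫⁻ ω, ∫⁻ t in Set.Icc 0 T, ‖ψ t ω‖ₑ ^ q ∂leb ∂P < ∞) :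
    ∀ᵐ t ∂leb, t < T → MemLp (ψ t) (ENNReal.ofReal q) P ∧
      Tendsto (fun ε => eLpNorm (fun ω => timeAverage T ψ (fun _ => t) ε ω - ψ t ω)
        (ENNReal.ofReal q) P) (𝓝[>] 0) (𝓝 0) := by
  have hq0 : 0 < q := one_pos.trans_le hq
  set F : ℝ≥0 → Ω → ℝ≥0∞ := fun s ω => ‖cutoff T ψ s ω‖ₑ ^ q with hF
  have hFm : Measurable (Function.uncurry F) := hψ.enorm.pow_const q
  have hFfin : ∫⁻ ω, ∫⁻ s, F s ω ∂leb ∂P ≠ ∞ := by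
    simp only [hF, lintegral_cutoff_rpow hq0]
    exact hfin.ne
  have hFω : ∀ᵐ ω ∂P, ∫⁻ s, F s ω ∂leb ≠ ∞ :=
    (ae_lt_top (hFm.comp measurable_swap).lintegral_prod_right' hFfin).mono fun ω h => h.ne
  have hΦm : Measurable fun s => ∫⁻ ω, F s ω ∂P := hFm.lintegral_prod_right'
  have hswap : ∀ S : Set ℝ≥0, ∫⁻ ω, ∫⁻ s in S, F s ω ∂leb ∂P = ∫⁻ s in S, ∫⁻ ω, F s ω ∂P ∂leb :=
    fun S => lintegral_lintegral_swap (hFm.comp measurable_swap).aemeasurable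
  have hΦfin : ∫⁻ s, ∫⁻ ω, F s ω ∂P ∂leb ≠ ∞ := by
    have h := hswap Set.univ
    simp only [Measure.restrict_univ] at h
    rwa [← h]
  filter_upwards [ae_ae_tendsto_average_right hψ (hint.mono fun ω h => integrable_cutoff h),
    ae_ae_tendsto_laverage_right hFm hFω, ae_tendsto_laverage_right hΦm hΦfin,
    ae_lt_top hΦm hΦfin] with t h1 h2 h3 h4 ht
  have key : ∀ e : ℕ → ℝ≥0, Tendsto e atTop (𝓝[>] 0) → MemLp (ψ t) (ENNReal.ofReal q) P ∧
      Tendsto (fun n => eLpNorm (fun ω => timeAverage T ψ (fun _ => t) (e n) ω - ψ t ω)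
        (ENNReal.ofReal q) P) atTop (𝓝 0) := by
    intro e he
    refine tendsto_eLpNorm_of_tendsto_majorant hq
      (A := fun n ω => (e n : ℝ≥0∞)⁻¹ * ∫⁻ s in Set.Ioc t (t + e n), F s ω ∂leb)
      (A' := F t) (fun n => (measurable_timeAverage hψ measurable_const _).aestronglyMeasurable)
      (fun n => ((measurable_setLIntegral_Ioc hFm t _).const_mul _).aemeasurable)
      (hFm.comp measurable_prodMk_left).aemeasurable (fun n => .of_forall fun ω => ?_) ?_ ?_
      h4.ne ?_
    · rw [timeAverage_eq_cutoff]
      exact enorm_average_rpow_le (hψ.comp measurable_prodMk_right) hq t (e n)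
    · filter_upwards [h1] with ω h
      simp only [timeAverage_eq_cutoff]
      rw [cutoff_of_le ht.le] at h
      exact h.comp he
    · filter_upwards [h2] with ω h using h.comp he
    · refine (h3.comp he).congr fun n => ?_
      rw [lintegral_const_mul _ (measurable_setLIntegral_Ioc hFm t _), hswap]
      rfl
  obtain ⟨e, he⟩ := exists_seq_tendsto (𝓝[>] (0 : ℝ≥0))
  exact ⟨(key e he).1, tendsto_of_seq_tendsto fun e he => (key e he).2⟩

theorem tendsto_average_of_tendsto_right {f : ℝ≥0 → ℝ} {a : ℝ≥0} {l : ℝ} (ha : a < T)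
    (hf : IntegrableOn f (Set.Icc 0 T) leb) (hl : Tendsto f (𝓝[>] a) (𝓝 l)) :
    Tendsto (fun ε : ℝ≥0 => (ε : ℝ)⁻¹ * ∫ s in Set.Ioc a (min (a + ε) T), f s ∂leb)
      (𝓝[>] 0) (𝓝 l) := by
  refine Metric.nhds_basis_closedBall.tendsto_right_iff.2 fun δ hδ => ?_
  obtain ⟨u, hu, hsub⟩ := (mem_nhdsGT_iff_exists_Ioo_subset).1
    (hl (Metric.closedBall_mem_nhds l hδ))
  have hv : a < min u T := lt_min hu ha
  filter_upwards [Ioo_mem_nhdsGT (tsub_pos_of_lt hv)] with ε hε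
  have hlt : a + ε < min u T := by
    rw [add_comm]
    exact lt_tsub_iff_right.1 hε.2
  have hmin : min (a + ε) T = a + ε := min_eq_left (hlt.le.trans (min_le_right _ _))
  have hε0 : 0 < (ε : ℝ) := NNReal.coe_pos.2 hε.1
  have hmeas : leb.real (Set.Ioc a (a + ε)) = ε := by
    rw [measureReal_def, leb_Ioc, NNReal.coe_add, add_sub_cancel_left,
      ENNReal.toReal_ofReal hε0.le]
  have hfin : leb (Set.Ioc a (a + ε)) < ∞ := by
    rw [leb_Ioc]
    exact ENNReal.ofReal_lt_top
  have h1 : ‖∫ s in Set.Ioc a (a + ε), (f s - l) ∂leb‖ ≤ δ * ε := by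
    rw [← hmeas]
    refine norm_setIntegral_le_of_norm_le_const hfin fun s hs => ?_
    have h2 : f s ∈ Metric.closedBall l δ :=
      hsub ⟨hs.1, hs.2.trans_lt (hlt.trans_le (min_le_left _ _))⟩
    rwa [mem_closedBall_iff_norm] at h2
  have h3 : ∫ s in Set.Ioc a (a + ε), (f s - l) ∂leb =
      (∫ s in Set.Ioc a (a + ε), f s ∂leb) - ε * l := by
    rw [integral_sub (hf.mono_set fun x hx =>
      ⟨zero_le, hx.2.trans (hlt.le.trans (min_le_right _ _))⟩)
      (integrableOn_const hfin.ne), setIntegral_const, hmeas, smul_eq_mul]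
  rw [hmin, mem_closedBall_iff_norm]
  have h4 : (ε : ℝ)⁻¹ * (∫ s in Set.Ioc a (a + ε), f s ∂leb) - l =
      (ε : ℝ)⁻¹ * ∫ s in Set.Ioc a (a + ε), (f s - l) ∂leb := by
    rw [h3, mul_sub, inv_mul_cancel_left₀ hε0.ne']
  rw [h4, norm_mul, norm_inv, Real.norm_of_nonneg hε0.le, inv_mul_le_iff₀ hε0, mul_comm]
  exact h1

theorem laverage_cutoff_rpow_le {q : ℝ} (hq : 0 < q) (t ε : ℝ≥0) (ω : Ω) :
    (ε : ℝ≥0∞)⁻¹ * ∫⁻ s in Set.Ioc t (t + ε), ‖cutoff T ψ s ω‖ₑ ^ q ∂leb ≤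
      ⨆ t ∈ Set.Icc 0 T, ‖ψ t ω‖ₑ ^ q := by
  set S := ⨆ t ∈ Set.Icc 0 T, ‖ψ t ω‖ₑ ^ q with hS
  have hle : ∀ s, ‖cutoff T ψ s ω‖ₑ ^ q ≤ S := fun s => by
    rcases le_or_gt s T with h | h
    · rw [cutoff_of_le h]
      exact le_iSup₂_of_le (f := fun t (_ : t ∈ Set.Icc 0 T) => ‖ψ t ω‖ₑ ^ q) s ⟨zero_le, h⟩ le_rfl
    · rw [cutoff_of_gt h, enorm_zero, ENNReal.zero_rpow_of_pos hq]
      exact zero_le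
  calc (ε : ℝ≥0∞)⁻¹ * ∫⁻ s in Set.Ioc t (t + ε), ‖cutoff T ψ s ω‖ₑ ^ q ∂leb
      ≤ (ε : ℝ≥0∞)⁻¹ * ∫⁻ _ in Set.Ioc t (t + ε), S ∂leb := by
        gcongr with s
        exact hle s
    _ = (ε : ℝ≥0∞)⁻¹ * ε * S := by
        rw [setLIntegral_const, leb_Ioc, NNReal.coe_add, add_sub_cancel_left,
          ENNReal.ofReal_coe_nnreal]
        ring
    _ ≤ S := mul_le_of_le_one_left' (ENNReal.inv_mul_le_one _)

theorem tendsto_eLpNorm_timeAverage (hψ : Measurable (Function.uncurry (cutoff T ψ)))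
    (hint : ∀ᵐ ω ∂P, IntegrableOn (fun s => ψ s ω) (Set.Icc 0 T) leb)
    (hlim : ∀ᵐ ω ∂P, ∀ t < T, ∃ l : ℝ, Tendsto (fun s => ψ s ω) (𝓝[>] t) (𝓝 l))
    {q : ℝ} (hq : 1 ≤ q) (hfin : ∫⁻ ω, ⨆ t ∈ Set.Icc 0 T, ‖ψ t ω‖ₑ ^ q ∂P < ∞)
    {τ : Ω → ℝ≥0} (hτ : Measurable τ) (hle : ∀ ω, τ ω ≤ T) :
    MemLp ({ω | τ ω < T}.indicator fun ω => Function.rightLim (fun s => ψ s ω) (τ ω))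
        (ENNReal.ofReal q) P ∧
      Tendsto (fun ε => eLpNorm (fun ω => timeAverage T ψ τ ε ω -
        {ω | τ ω < T}.indicator (fun ω => Function.rightLim (fun s => ψ s ω) (τ ω)) ω)
        (ENNReal.ofReal q) P) (𝓝[>] 0) (𝓝 0) := by
  have hq0 : 0 < q := one_pos.trans_le hq
  have hpt : ∀ᵐ ω ∂P, Tendsto (fun ε => timeAverage T ψ τ ε ω) (𝓝[>] 0)
      (𝓝 ({ω | τ ω < T}.indicator (fun ω => Function.rightLim (fun s => ψ s ω) (τ ω)) ω)) := by
    filter_upwards [hint, hlim] with ω h1 h2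
    rcases (hle ω).lt_or_eq with h | h
    · rw [Set.indicator_of_mem (show ω ∈ {ω | τ ω < T} from h)]
      obtain ⟨l, hl⟩ := h2 _ h
      exact tendsto_average_of_tendsto_right h h1 (tendsto_rightLim_of_tendsto ⟨l, hl⟩)
    -- At `τ = T` the averaging interval is empty, which matches the zero value of the indicator.
    · rw [Set.indicator_of_notMem (show ω ∉ {ω | τ ω < T} from fun h' => (ne_of_lt h') h)]
      refine tendsto_const_nhds.congr fun ε => ?_
      simp [timeAverage, h]
  have key : ∀ e : ℕ → ℝ≥0, Tendsto e atTop (𝓝[>] 0) →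
      MemLp ({ω | τ ω < T}.indicator fun ω => Function.rightLim (fun s => ψ s ω) (τ ω))
        (ENNReal.ofReal q) P ∧
      Tendsto (fun n => eLpNorm (fun ω => timeAverage T ψ τ (e n) ω -
        {ω | τ ω < T}.indicator (fun ω => Function.rightLim (fun s => ψ s ω) (τ ω)) ω)
        (ENNReal.ofReal q) P) atTop (𝓝 0) := by
    intro e he
    have hm : ∀ n, Measurable (timeAverage T ψ τ (e n)) := fun n => measurable_timeAverage hψ hτ _
    -- The majorant is the countable supremum of the averages themselves: it is measurable and
    -- bounded by `sup |ψ|^q`, whose own measurability is not available.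
    have hG : Measurable fun ω => ⨆ n, ‖timeAverage T ψ τ (e n) ω‖ₑ ^ q :=
      .iSup fun n => (hm n).enorm.pow_const q
    have hGle : ∀ ω, ⨆ n, ‖timeAverage T ψ τ (e n) ω‖ₑ ^ q ≤
        ⨆ t ∈ Set.Icc 0 T, ‖ψ t ω‖ₑ ^ q := fun ω => iSup_le fun n => by
      rw [timeAverage_eq_cutoff]
      exact (enorm_average_rpow_le (hψ.comp measurable_prodMk_right) hq _ _).trans
        (laverage_cutoff_rpow_le hq0 _ _ ω)
    exact tendsto_eLpNorm_of_tendsto_majorant hq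
      (A := fun _ ω => ⨆ n, ‖timeAverage T ψ τ (e n) ω‖ₑ ^ q)
      (A' := fun ω => ⨆ n, ‖timeAverage T ψ τ (e n) ω‖ₑ ^ q)
      (fun n => (hm n).aestronglyMeasurable) (fun _ => hG.aemeasurable) hG.aemeasurable
      (fun n => .of_forall fun ω => le_iSup (fun n => ‖timeAverage T ψ τ (e n) ω‖ₑ ^ q) n)
      (hpt.mono fun ω h => h.comp he) (.of_forall fun ω => tendsto_const_nhds)
      ((lintegral_mono hGle).trans_lt hfin).ne tendsto_const_nhds
  obtain ⟨e, he⟩ := exists_seq_tendsto (𝓝[>] (0 : ℝ≥0))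
  exact ⟨(key e he).1, tendsto_of_seq_tendsto fun e he => (key e he).2⟩

/-- A solution of a BSDE has drift `-g(t, Y_t, Z_t, U_t)`. -/
theorem IsBSDESolution.exists_hasDrift {m d : ℕ} {ν : Measure (Punctured d)} [SigmaFinite ν]
    {B : Noise P m ν} {g : ℝ≥0 → Ω → ℝ → Euc m → Lambda2 ν → ℝ} {X : Ω → ℝ}
    {Y : ℝ≥0 → Ω → ℝ} {Z : ℝ≥0 → Ω → Euc m} {U : ℝ≥0 → Ω → Lambda2 ν}
    (h : IsBSDESolution B T g X Y Z U) :
    ∃ M, HasDrift B.filtration P T Y M (driverAlong g Y Z U) := by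
  obtain ⟨M, hM, hMc, heq⟩ := exists_martingale_of_isBSDESolution B h
  exact ⟨M, h.memS2, hM, hMc, ae_forall_sub_eq h.integrable (ae_forall_eq_of_forall_ae_eq
    (fun ω => (h.memS2.cadlag ω).1) hMc h.integrable heq)⟩

theorem isAdmissibleTime_const {𝓕 : Filtration ℝ≥0 mΩ} {t : ℝ≥0} (ht : t < T) :
    IsAdmissibleTime 𝓕 P T (fun _ => t) where
  isStoppingTime := isStoppingTime_const 𝓕 t
  le_horizon _ := ht.le
  pos := by simp [ht]

end

end Resilience

end


/-! ### The theorem, from the drift decomposition and the two convergence results. -/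

theorem mainTheorem1 {Ω : Type*} [mΩ : MeasurableSpace Ω]
    (P : Measure Ω) [IsProbabilityMeasure P] [P.IsComplete]
    {m d : ℕ} (ν : Measure (Resilience.Punctured d)) [SigmaFinite ν]
    (hν : Resilience.IsLevyMeasure ν) (B : Resilience.Noise P m ν)
    (T : ℝ≥0) (hT : 0 < T)
    (g : ℝ≥0 → Ω → ℝ → Resilience.Euc m → Resilience.Lambda2 ν → ℝ)
    (hg : Resilience.IsDriver B.filtration T g)
    (X : Ω → ℝ) (hX : Measurable[B.filtration T] X)
    (ρ : ℝ≥0 → Ω → ℝ) (Z : ℝ≥0 → Ω → Resilience.Euc m) (U : ℝ≥0 → Ω → Resilience.Lambda2 ν)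
    (hsol : Resilience.IsBSDESolution B T g X ρ Z U) :
    -- (i) deterministic times
    (∀ q : ℝ, 1 ≤ q →
      ∫⁻ ω, ∫⁻ t in Set.Icc 0 T, ‖Resilience.driverAlong g ρ Z U t ω‖ₑ ^ q ∂(Resilience.leb) ∂P < ∞ →
      ∀ᵐ t ∂(Resilience.leb), t < T →
        MemLp (Resilience.driverAlong g ρ Z U t) (ENNReal.ofReal q) P ∧
        (∀ s ≤ t,
          Resilience.HasConditionalResilienceRate B.filtration P T ρ (fun _ => t) (fun _ => s)
            (isStoppingTime_const B.filtration s) (ENNReal.ofReal q)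
            (fun ω => -(P[Resilience.driverAlong g ρ Z U t | B.filtration s]) ω)) ∧
        Resilience.HasResilienceRate B.filtration P T ρ (fun _ => t)
          ((-∫ ω, Resilience.driverAlong g ρ Z U t ω ∂P : ℝ) : EReal)) ∧
    -- (ii) stopping times
    (∀ q : ℝ, 1 ≤ q →
      (∀ᵐ ω ∂P, ∀ t < T, ∃ l : ℝ,
        Tendsto (fun s => Resilience.driverAlong g ρ Z U s ω) (𝓝[>] t) (𝓝 l)) →
      (∀ᵐ ω ∂P, {t ∈ Set.Icc 0 T | ¬ ContinuousWithinAt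
        (fun s => Resilience.driverAlong g ρ Z U s ω) (Set.Icc 0 T) t}.Countable) →
      ∫⁻ ω, ⨆ t ∈ Set.Icc 0 T, ‖Resilience.driverAlong g ρ Z U t ω‖ₑ ^ q ∂P < ∞ →
      ∀ (τ σ : Ω → ℝ≥0) (_ : Resilience.IsAdmissibleTime B.filtration P T τ)
        (hσ : Resilience.IsAdmissibleTime B.filtration P T σ), (∀ᵐ ω ∂P, σ ω ≤ τ ω) →
        MemLp ({ω | τ ω < T}.indicator fun ω =>
          Function.rightLim (fun s => Resilience.driverAlong g ρ Z U s ω) (τ ω))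
          (ENNReal.ofReal q) P ∧
        Resilience.HasConditionalResilienceRate B.filtration P T ρ τ σ hσ.isStoppingTime
          (ENNReal.ofReal q)
          (fun ω => -(P[{ω | τ ω < T}.indicator fun ω =>
              Function.rightLim (fun s => Resilience.driverAlong g ρ Z U s ω) (τ ω)
            | hσ.isStoppingTime.measurableSpace]) ω / P.real {ω | τ ω < T}) ∧
        Resilience.HasResilienceRate B.filtration P T ρ τ
          ((-∫ ω, Function.rightLim (fun s => Resilience.driverAlong g ρ Z U s ω) (τ ω)
            ∂(P[|{ω | τ ω < T}]) : ℝ) : EReal)) := by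
  obtain ⟨M, hM⟩ := hsol.exists_hasDrift
  have hψ := Resilience.measurable_cutoff_driverAlong hg hsol.memS2 hsol.memH2_Z hsol.memH2_U
  refine ⟨fun q hq hfin => ?_, fun q hq hlim _ hfin τ σ hτ hσ hστ => ?_⟩
  · have hq' : 1 ≤ ENNReal.ofReal q := by simpa using ENNReal.ofReal_le_ofReal hq
    filter_upwards [Resilience.ae_tendsto_eLpNorm_timeAverage_const hψ hsol.integrable hq hfin]
      with t ht htT
    obtain ⟨hmem, hconv⟩ := ht htT
    have hadm : Resilience.IsAdmissibleTime B.filtration P T (fun _ => t) :=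
      Resilience.isAdmissibleTime_const htT
    have hone : P.real {ω : Ω | t < T} = 1 := by simp [htT]
    refine ⟨hmem, fun s hs => ?_, ?_⟩
    · have h := hM.hasConditionalResilienceRate hadm (isStoppingTime_const B.filtration s)
        (.of_forall fun _ => hs) hq' hmem hconv
      simpa only [hone, div_one, IsStoppingTime.measurableSpace_const] using h
    · have h := hM.hasResilienceRate hadm hq' hmem hconv
      simpa only [hone, inv_one, one_mul] using h
  · have hq' : 1 ≤ ENNReal.ofReal q := by simpa using ENNReal.ofReal_le_ofReal hq
    have hτm := Resilience.measurable_of_isStoppingTime hτ.isStoppingTime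
    obtain ⟨hmem, hconv⟩ := Resilience.tendsto_eLpNorm_timeAverage hψ hsol.integrable hlim hq hfin
      hτm hτ.le_horizon
    refine ⟨hmem, hM.hasConditionalResilienceRate hτ hσ.isStoppingTime hστ hq' hmem hconv, ?_⟩
    have h := hM.hasResilienceRate hτ hq' hmem hconv
    rw [integral_indicator (measurableSet_lt hτm measurable_const)] at h
    rw [ProbabilityTheory.cond, integral_smul_measure, ENNReal.toReal_inv, smul_eq_mul]
    exact h
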